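/- **Theorem.** Let $(M,g)$ be a smooth Riemannian manifold of dimension $n$, let $G$ be a Lie subgroup of $O(n)$ with Lie algebra $\mathfrak g\subset\mathfrak{so}(n)$, let $V=\mathbb R^n$ be its standard representation, and let $\mathfrak g^\perp$ be the orthogonal complement of $\mathfrak g$ in $\mathfrak{so}(n)$. Let $P$ be a $G$-structure on $(M,g)$, that is, a reduction of the orthonormal frame bundle of $M$ to $G$. Let $\nabla^g$ be the Levi-Civita connection. The intrinsic torsion $\xi$ of $P$ is the component in $V\otimes\mathfrak g^\perp$ of $\nabla^g-\hat\nabla\in V\otimes\mathfrak{so}(n)$, where $\hat\nabla$ is any (local) connection induced from a principal connection on $P$; it does not depend on $\hat\nabla$. It is regarded as a $G$-equivariant map $P\to V\otimes\mathfrak g^\perp$. Let $W\subset V\otimes\mathfrak g^\perp$ be a $G$-submodule such that $\xi$ takes values in $W$. Let $S^2_0V$ be the space of trace-free symmetric $2$-tensors on $V$, and let $$\mathcal K(\mathfrak g)=\{R\in\Lambda^2V\otimes\mathfrak g : R_{X,Y}Z+R_{Y,Z}X+R_{Z,X}Y=0 \text{ for all } X,Y,Z\in V\}$$ be the space of algebraic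 curvature tensors with values in $\mathfrak g$. Suppose that (a) $(V\otimes W\otimes S^2_0V)^G=\{0\}$, (b) $(S^2W\otimes S^2_0V)^G=\{0\}$, (c) $(\mathcal K(\mathfrak g)\otimes S^2_0V)^G=\{0\}$. Then $g$ is Einstein: the trace-free part of the Ricci tensor vanishes, that is, $\mathrm{Ric}=\lambda g$ for a function $\lambda$ on $M$, and if $n\neq 2$ then $\lambda$ is locally constant (so it is constant when $M$ is connected). -/

import Mathlib

open scoped Manifold ContDiff TensorProduct

namespace GStructures

noncomputable section

/-- Euclidean `n`-space, the standard representation `V` of `O(n)`. -/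
abbrev Vec (n : ℕ) : Type := EuclideanSpace ℝ (Fin n)

/-! ### Linear algebra of a subgroup `G` of `O(n)`

`O(n)` is the group `Vec n ≃ₗᵢ[ℝ] Vec n`.  Representations are identified with their duals, so that
`V ⊗ End V` is the space of linear maps `V → End V`, and so on. -/

section Algebra

variable {n : ℕ} (G : Subgroup (Vec n ≃ₗᵢ[ℝ] Vec n))

/-- The representation `V` of `G` on `ℝⁿ`. -/
def stdRep : Representation ℝ G (Vec n) where
  toFun h := ((h : Vec n ≃ₗᵢ[ℝ] Vec n).toLinearEquiv : Vec n →ₗ[ℝ] Vec n)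
  map_one' := rfl
  map_mul' _ _ := rfl

@[simp] lemma stdRep_apply (h : G) (v : Vec n) :
    stdRep G h v = (h : Vec n ≃ₗᵢ[ℝ] Vec n) v := rfl

lemma stdRep_self_inv (h : G) (v : Vec n) : stdRep G h (stdRep G h⁻¹ v) = v := by
  rw [← Module.End.mul_apply, ← map_mul]; simp

lemma stdRep_inv_self (h : G) (v : Vec n) : stdRep G h⁻¹ (stdRep G h v) = v := by
  rw [← Module.End.mul_apply, ← map_mul]; simp

lemma stdRep_inner (h : G) (v w : Vec n) :
    inner ℝ (stdRep G h v) (stdRep G h w) = inner ℝ v w :=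
  (h : Vec n ≃ₗᵢ[ℝ] Vec n).inner_map_map v w

lemma stdRep_inner_left (h : G) (v w : Vec n) :
    inner ℝ (stdRep G h v) w = inner ℝ v (stdRep G h⁻¹ w) := by
  rw [← stdRep_inner G h v, stdRep_self_inv]

/-- The representation of `G` on `End V` by conjugation. -/
def endRep : Representation ℝ G (Vec n →ₗ[ℝ] Vec n) :=
  Representation.linHom (stdRep G) (stdRep G)

lemma endRep_apply (h : G) (A : Vec n →ₗ[ℝ] Vec n) (v : Vec n) :
    endRep G h A v = stdRep G h (A (stdRep G h⁻¹ v)) := rfl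

/-- The representation of `G` on `V ⊗ End V`. -/
def tensorRep : Representation ℝ G (Vec n →ₗ[ℝ] Vec n →ₗ[ℝ] Vec n) :=
  Representation.linHom (stdRep G) (endRep G)

lemma tensorRep_apply (h : G) (T : Vec n →ₗ[ℝ] Vec n →ₗ[ℝ] Vec n) (X : Vec n) :
    tensorRep G h T X = endRep G h (T (stdRep G h⁻¹ X)) := rfl

/-- The representation of `G` on `V ⊗ V ⊗ End V`. -/
def curvRep : Representation ℝ G (Vec n →ₗ[ℝ] Vec n →ₗ[ℝ] Vec n →ₗ[ℝ] Vec n) :=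
  Representation.linHom (stdRep G) (tensorRep G)

lemma curvRep_apply (h : G) (R : Vec n →ₗ[ℝ] Vec n →ₗ[ℝ] Vec n →ₗ[ℝ] Vec n) (X Y Z : Vec n) :
    curvRep G h R X Y Z =
      stdRep G h (R (stdRep G h⁻¹ X) (stdRep G h⁻¹ Y) (stdRep G h⁻¹ Z)) := rfl

/-- An isometry, as a continuous linear map. -/
abbrev isoCLM (h : Vec n ≃ₗᵢ[ℝ] Vec n) : Vec n →L[ℝ] Vec n :=
  (h.toContinuousLinearEquiv : Vec n →L[ℝ] Vec n)

/-- The Lie algebra `𝔤 ⊆ End V` of `G`: the velocities at the identity of the smooth curves in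
`End V` that run inside `G`.  For every Lie subgroup of `O(n)`, closed or only immersed, this is
the usual Lie algebra. -/
def lieAlg : Submodule ℝ (Vec n →ₗ[ℝ] Vec n) where
  carrier := {A | ∃ γ : ℝ → (Vec n →L[ℝ] Vec n), ContDiff ℝ ∞ γ ∧ (∀ t, ∃ h ∈ G, γ t = isoCLM h) ∧
    γ 0 = ContinuousLinearMap.id ℝ (Vec n) ∧ HasDerivAt γ (LinearMap.toContinuousLinearMap A) 0}
  zero_mem' := by
    refine ⟨fun _ => ContinuousLinearMap.id ℝ (Vec n), contDiff_const,
      fun _ => ⟨1, G.one_mem, rfl⟩, rfl, ?_⟩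
    simpa using hasDerivAt_const (0 : ℝ) (ContinuousLinearMap.id ℝ (Vec n))
  add_mem' := by
    rintro A B ⟨γ, hγ, hγG, hγ0, hγd⟩ ⟨δ, hδ, hδG, hδ0, hδd⟩
    refine ⟨fun t => (γ t).comp (δ t), hγ.clm_comp hδ, fun t => ?_, ?_, ?_⟩
    · obtain ⟨h, hh, e⟩ := hγG t
      obtain ⟨k, hk, e'⟩ := hδG t
      refine ⟨h * k, G.mul_mem hh hk, ?_⟩
      simp only [e, e']
      rfl
    · simp [hγ0, hδ0]
    · have := hγd.clm_comp hδd
      rw [hγ0, hδ0] at this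
      simpa using this
  smul_mem' := by
    rintro c A ⟨γ, hγ, hγG, hγ0, hγd⟩
    refine ⟨fun t => γ (c * t), hγ.comp (contDiff_const.mul contDiff_id), fun t => hγG _, ?_, ?_⟩
    · simp [hγ0]
    · have h1 : HasDerivAt (fun t : ℝ => c * t) c 0 := by
        simpa using (hasDerivAt_id (0 : ℝ)).const_mul c
      have h2 : HasDerivAt γ (LinearMap.toContinuousLinearMap A) (c * 0) := by simpa using hγd
      exact h2.scomp (0 : ℝ) h1

lemma endRep_mem_lieAlg (h : G) {A : Vec n →ₗ[ℝ] Vec n} (hA : A ∈ lieAlg G) :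
    endRep G h A ∈ lieAlg G := by
  obtain ⟨γ, hγ, hγG, hγ0, hγd⟩ := hA
  refine ⟨fun t => (isoCLM (h : Vec n ≃ₗᵢ[ℝ] Vec n)).comp
    ((γ t).comp (isoCLM ((h⁻¹ : G) : Vec n ≃ₗᵢ[ℝ] Vec n))),
    contDiff_const.clm_comp (hγ.clm_comp contDiff_const), fun t => ?_, ?_, ?_⟩
  · obtain ⟨k, hk, e⟩ := hγG t
    refine ⟨h * (k * (h⁻¹ : G)), G.mul_mem h.2 (G.mul_mem hk (h⁻¹ : G).2), ?_⟩
    simp only [e]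
    rfl
  · simp only [hγ0]
    ext1 v
    exact stdRep_self_inv G h v
  · have h1 := (hasDerivAt_const (0 : ℝ) (isoCLM (h : Vec n ≃ₗᵢ[ℝ] Vec n))).clm_comp
      (hγd.clm_comp (hasDerivAt_const (0 : ℝ) (isoCLM ((h⁻¹ : G) : Vec n ≃ₗᵢ[ℝ] Vec n))))
    refine h1.congr_deriv ?_
    ext1 v
    simp
    rfl

/-- The orthogonal complement `𝔤^⊥` of `𝔤` in `𝔰𝔬(n)`, with respect to the invariant inner
product `⟨A, B⟩ = -tr (A B)` on `𝔰𝔬(n)`. -/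
def lieAlgPerp : Submodule ℝ (Vec n →ₗ[ℝ] Vec n) where
  carrier := {A | (∀ v w, inner ℝ (A v) w = -inner ℝ v (A w)) ∧
    ∀ B ∈ lieAlg G, LinearMap.trace ℝ (Vec n) (A ∘ₗ B) = 0}
  zero_mem' := by simp
  add_mem' := by
    rintro A B ⟨hA, hA'⟩ ⟨hB, hB'⟩
    refine ⟨fun v w => ?_, fun C hC => ?_⟩
    · simp only [LinearMap.add_apply, inner_add_left, inner_add_right, hA, hB]; ring
    · simp [LinearMap.add_comp, hA' C hC, hB' C hC]
  smul_mem' := by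
    rintro c A ⟨hA, hA'⟩
    refine ⟨fun v w => ?_, fun C hC => ?_⟩
    · simp only [LinearMap.smul_apply, real_inner_smul_left, real_inner_smul_right, hA]; ring
    · simp [LinearMap.smul_comp, hA' C hC]

/-- `S²₀V`: the symmetric endomorphisms of `V` with vanishing trace. -/
def traceFreeSym : Subrepresentation (endRep G) where
  toSubmodule :=
    { carrier := {A | (∀ v w, inner ℝ (A v) w = inner ℝ v (A w)) ∧
        LinearMap.trace ℝ (Vec n) A = 0}
      zero_mem' := by simp
      add_mem' := by
        rintro A B ⟨hA, hA'⟩ ⟨hB, hB'⟩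
        refine ⟨fun v w => ?_, by simp [hA', hB']⟩
        simp only [LinearMap.add_apply, inner_add_left, inner_add_right, hA, hB]
      smul_mem' := by
        rintro c A ⟨hA, hA'⟩
        refine ⟨fun v w => ?_, by simp [hA']⟩
        simp only [LinearMap.smul_apply, real_inner_smul_left, real_inner_smul_right, hA] }
  apply_mem_toSubmodule := by
    rintro h A ⟨hA, hA'⟩
    refine ⟨fun v w => ?_, ?_⟩
    · rw [endRep_apply, endRep_apply, stdRep_inner_left, hA]
      have := stdRep_inner_left G h⁻¹ v (A (stdRep G h⁻¹ w))
      rw [inv_inv] at this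
      exact this
    · have h1 : endRep G h A = stdRep G h * (A * stdRep G h⁻¹) := rfl
      rw [h1, LinearMap.trace_mul_comm, mul_assoc, ← map_mul]
      simpa using hA'

/-- `𝒦(𝔤)`, the algebraic curvature tensors with values in `𝔤`: the kernel of the Bianchi map on
`Λ²V ⊗ 𝔤`. -/
def algCurv : Subrepresentation (curvRep G) where
  toSubmodule :=
    { carrier := {R | (∀ X Y, R X Y = -R Y X) ∧ (∀ X Y, R X Y ∈ lieAlg G) ∧
        ∀ X Y Z, R X Y Z + R Y Z X + R Z X Y = 0}
      zero_mem' := by simp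
      add_mem' := by
        rintro R S ⟨h1, h2, h3⟩ ⟨k1, k2, k3⟩
        refine ⟨fun X Y => ?_, fun X Y => (lieAlg G).add_mem (h2 X Y) (k2 X Y), fun X Y Z => ?_⟩
        · simp only [LinearMap.add_apply]; rw [h1, k1]; abel
        · simp only [LinearMap.add_apply]
          rw [show ∀ a b c d e f : Vec n, a + b + (c + d) + (e + f) = a + c + e + (b + d + f) by
            intros; abel, h3, k3, add_zero]
      smul_mem' := by
        rintro c R ⟨h1, h2, h3⟩
        refine ⟨fun X Y => ?_, fun X Y => (lieAlg G).smul_mem c (h2 X Y), fun X Y Z => ?_⟩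
        · simp only [LinearMap.smul_apply]; rw [h1, smul_neg]
        · simp only [LinearMap.smul_apply]; rw [← smul_add, ← smul_add, h3, smul_zero] }
  apply_mem_toSubmodule := by
    rintro h R ⟨h1, h2, h3⟩
    refine ⟨fun X Y => ?_, fun X Y => endRep_mem_lieAlg G h (h2 _ _), fun X Y Z => ?_⟩
    · ext1 Z
      rw [LinearMap.neg_apply, curvRep_apply, curvRep_apply, h1, LinearMap.neg_apply, map_neg]
    · rw [curvRep_apply, curvRep_apply, curvRep_apply, ← map_add, ← map_add, h3, map_zero]

/-- `S²W` for a representation `W`: the symmetric tensors in `W ⊗ W`. -/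
def symSquare {W : Type*} [AddCommMonoid W] [Module ℝ W] (ρ : Representation ℝ G W) :
    Subrepresentation (ρ.tprod ρ) where
  toSubmodule := LinearMap.eqLocus (TensorProduct.comm ℝ W W : W ⊗[ℝ] W →ₗ[ℝ] W ⊗[ℝ] W)
    LinearMap.id
  apply_mem_toSubmodule := by
    intro h t ht
    have ht' : TensorProduct.comm ℝ W W t = t := ht
    change TensorProduct.comm ℝ W W (TensorProduct.map (ρ h) (ρ h) t) =
      TensorProduct.map (ρ h) (ρ h) t
    rw [← TensorProduct.map_comm, ht']

/-- `E^G = {0}`: the only invariant vector of the representation `E` is zero. -/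
def NoInvariants {E : Type*} [AddCommMonoid E] [Module ℝ E] (ρ : Representation ℝ G E) : Prop :=
  ∀ t : E, (∀ h : G, ρ h t = t) → t = 0

end Algebra

/-! ### Riemannian geometry in charts -/

section Geometry

variable {n : ℕ} {M : Type*} [TopologicalSpace M] [ChartedSpace (Vec n) M]

/-- Smooth Riemannian metrics on `M`. -/
abbrev RiemMetric (n : ℕ) (M : Type*) [TopologicalSpace M] [ChartedSpace (Vec n) M]
    [IsManifold 𝓘(ℝ, Vec n) ∞ M] : Type _ :=
  Bundle.ContMDiffRiemannianMetric 𝓘(ℝ, Vec n) ∞ (Vec n)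
    (fun x : M => TangentSpace 𝓘(ℝ, Vec n) x)

variable [IsManifold 𝓘(ℝ, Vec n) ∞ M] (g : RiemMetric n M)
  (φ : OpenPartialHomeomorph M (Vec n))

/-- The derivative at `u` of the inverse of the chart `φ`. -/
def chartInvDeriv (u : Vec n) : Vec n →L[ℝ] TangentSpace 𝓘(ℝ, Vec n) (φ.symm u) :=
  mfderiv 𝓘(ℝ, Vec n) 𝓘(ℝ, Vec n) φ.symm u

/-- The metric in the chart `φ`: `(∑ a^i ∂_i, ∑ b^j ∂_j) ↦ ∑ g_ij a^i b^j` at the point `u`. -/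
def coordMetric (u : Vec n) : Vec n →L[ℝ] Vec n →L[ℝ] ℝ :=
  LinearMap.toContinuousLinearMap
    ((LinearMap.toContinuousLinearMap : (Vec n →ₗ[ℝ] ℝ) ≃ₗ[ℝ] (Vec n →L[ℝ] ℝ)).toLinearMap ∘ₗ
      LinearMap.mk₂ ℝ
        (fun a b => g.inner (φ.symm u) (chartInvDeriv φ u a) (chartInvDeriv φ u b))
        (by intros; simp) (by intros; simp) (by intros; simp) (by intros; simp))

lemma coordMetric_apply (u a b : Vec n) : coordMetric g φ u a b =
    g.inner (φ.symm u) (chartInvDeriv φ u a) (chartInvDeriv φ u b) := rfl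

/-- The Christoffel symbols: `Γ(a, b) = ∑ Γ^k_ij a^i b^j ∂_k`, the vector such that
`g(Γ(a, b), c) = (∂_a g(b, c) + ∂_b g(a, c) - ∂_c g(a, b)) / 2` for all `c`. -/
def christoffel (u a b : Vec n) : Vec n :=
  let D := fderiv ℝ (coordMetric g φ) u
  (coordMetric g φ u).inverse ((1 / 2 : ℝ) • (D a b + D b a - (D.flip a).flip b))

/-- The Riemannian curvature `R_{a,b} c` in the chart `φ`, with the sign convention
`R_{X,Y} = [∇_X, ∇_Y] - ∇_[X,Y]`. -/
def curvature (u a b c : Vec n) : Vec n :=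
  fderiv ℝ (fun v => christoffel g φ v b c) u a - fderiv ℝ (fun v => christoffel g φ v a c) u b
    + christoffel g φ u a (christoffel g φ u b c) - christoffel g φ u b (christoffel g φ u a c)

/-- The Ricci curvature in the chart `φ`: `Ric(b, c)` is the trace of `a ↦ R_{a,b} c`. -/
def ricci (u b c : Vec n) : ℝ :=
  ∑ i : Fin n, curvature g φ u (EuclideanSpace.single i 1) b c i

/-- The metric is Einstein: `Ric = lam g` for a function `lam`, and `lam` is locally constant
unless `n = 2` (a surface always satisfies `Ric = K g`, with `K` its Gauss curvature). -/
def IsEinstein : Prop :=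
  ∃ lam : M → ℝ,
    (∀ φ ∈ IsManifold.maximalAtlas 𝓘(ℝ, Vec n) ∞ M, ∀ u ∈ φ.target, ∀ b c : Vec n,
      ricci g φ u b c = lam (φ.symm u) * coordMetric g φ u b c) ∧
    (n ≠ 2 → IsLocallyConstant lam)

/-- A reduction of the orthonormal frame bundle of `(M, g)` to the subgroup `G` of `O(n)`.  A frame
at `x` is a linear isometry from `ℝⁿ` to the tangent space at `x`. -/
structure GStructure (G : Subgroup (Vec n ≃ₗᵢ[ℝ] Vec n)) where
  /-- The frames at a point that belong to the reduction. -/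
  frames : ∀ x : M, Set (Vec n →L[ℝ] TangentSpace 𝓘(ℝ, Vec n) x)
  orthonormal : ∀ x, ∀ p ∈ frames x, ∀ a b, g.inner x (p a) (p b) = inner ℝ a b
  right_action : ∀ x, ∀ p ∈ frames x, ∀ h ∈ G, p.comp (isoCLM h) ∈ frames x
  transitive : ∀ x, ∀ p ∈ frames x, ∀ q ∈ frames x, ∃ h ∈ G, q = p.comp (isoCLM h)
  /-- Every point has a neighbourhood with a smooth section. -/
  exists_section : ∀ x, ∃ U : Set M, IsOpen U ∧ x ∈ U ∧
    ∃ s : ∀ y : M, Vec n →L[ℝ] TangentSpace 𝓘(ℝ, Vec n) y, (∀ y ∈ U, s y ∈ frames y) ∧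
      ∀ a : Vec n, ContMDiffOn 𝓘(ℝ, Vec n) 𝓘(ℝ, Vec n).tangent ∞
        (fun y => (⟨y, s y a⟩ : TangentBundle 𝓘(ℝ, Vec n) M)) U

variable {g}

/-- `s` is a smooth section over the open set `U` of the frames of the `G`-structure. -/
def GStructure.IsSection {G : Subgroup (Vec n ≃ₗᵢ[ℝ] Vec n)} (P : GStructure g G) (U : Set M)
    (s : ∀ y : M, Vec n →L[ℝ] TangentSpace 𝓘(ℝ, Vec n) y) : Prop :=
  IsOpen U ∧ (∀ y ∈ U, s y ∈ P.frames y) ∧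
    ∀ a : Vec n, ContMDiffOn 𝓘(ℝ, Vec n) 𝓘(ℝ, Vec n).tangent ∞
      (fun y => (⟨y, s y a⟩ : TangentBundle 𝓘(ℝ, Vec n) M)) U

/-- The field of frames `s`, seen in the chart `φ`. -/
def frameInChart (s : ∀ y : M, Vec n →L[ℝ] TangentSpace 𝓘(ℝ, Vec n) y) (v : Vec n) :
    Vec n →L[ℝ] Vec n :=
  (mfderiv 𝓘(ℝ, Vec n) 𝓘(ℝ, Vec n) φ (φ.symm v)).comp (s (φ.symm v))

variable (g) in
/-- Let `e` be the field of frames `s`.  This is `e⁻¹ (∇_{eX} (eY))`, the value in the frame `e` of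
the connection form of the Levi-Civita connection `∇`.  Equivalently, it is the value in the
frame `e` of the torsion tensor `η = ∇ - ∇'`, where `∇'` is the local connection for
which `e` is parallel; if `s` is a section of a `G`-structure, then `∇'` is a `G`-connection. -/
def connectionForm (s : ∀ y : M, Vec n →L[ℝ] TangentSpace 𝓘(ℝ, Vec n) y) (u X Y : Vec n) : Vec n :=
  let e := frameInChart φ s
  (e u).inverse (fderiv ℝ e u (e u X) Y + christoffel g φ u (e u X) (e u Y))

/-- `ξ` is the value of the intrinsic torsion at `φ⁻¹(u)` in the frame given by the section `s`
of a `G`-structure: the component in `V ⊗ 𝔤^⊥` of the torsion tensor `η` of a `G`-connection,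
that is, `ξ` has values in `𝔤^⊥` and `η - ξ` has values in `𝔤`. -/
def IsIntrinsicTorsion {G : Subgroup (Vec n ≃ₗᵢ[ℝ] Vec n)} (_P : GStructure g G)
    (s : ∀ y : M, Vec n →L[ℝ] TangentSpace 𝓘(ℝ, Vec n) y) (u : Vec n)
    (ξ : Vec n →ₗ[ℝ] Vec n →ₗ[ℝ] Vec n) : Prop :=
  (∀ X, ξ X ∈ lieAlgPerp G) ∧
    ∀ X, ∃ A ∈ lieAlg G, ∀ Y, connectionForm g φ s u X Y = ξ X Y + A Y

/-- The intrinsic torsion of the `G`-structure takes values in `W`: its value in each frame of the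
`G`-structure belongs to `W`. -/
def GStructure.TorsionIn {G : Subgroup (Vec n ≃ₗᵢ[ℝ] Vec n)} (P : GStructure g G)
    (W : Subrepresentation (tensorRep G)) : Prop :=
  ∀ φ ∈ IsManifold.maximalAtlas 𝓘(ℝ, Vec n) ∞ M, ∀ U s, P.IsSection U s →
    ∀ u ∈ φ.target, φ.symm u ∈ U → ∃ ξ ∈ W.toSubmodule, IsIntrinsicTorsion φ P s u ξ

end Geometry

end

end GStructures

open GStructures

/-! In a local section of `P` the Levi-Civita connection form is a function `θ` into the fixed
vector space `V ⊗ 𝔰𝔬(n)`, and it splits as `θ = ξ + A` with `ξ` in `W` and `A` in `V ⊗ 𝔤`. Put this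
into the structure equation for the curvature in the frame. The result is `R(X,Y) = (D_X ξ)_Y - (D_Y
ξ)_X + Q(ξ,ξ)(X,Y) + S(X,Y)`, where `D` is the `G`-connection with form `A`, `Q(ξ,ξ)(X,Y) = [ξ_X,
ξ_Y] - ξ_{ξ_X Y - ξ_Y X}`, and `S` lies in `Λ²V ⊗ 𝔤` (`frameCurv_decomposition`,
`IsFrameConnection.curvRemainder_eq`). Since `W` is a linear subspace stable under `𝔤`, `D_X ξ` lies
again in `W`.

The tensor `S` alone need not satisfy the Bianchi identity, so (c) does not apply to it directly. It
says, by Schur, that the trace-free Ricci contraction vanishes on `𝒦(𝔤)`, the kernel of the Bianchi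
map in `Λ²V ⊗ 𝔤`. Therefore, on tensors `T + S` killed by the Bianchi map, with `S` in `Λ²V ⊗ 𝔤`,
the contraction is an equivariant linear function `Φ` of `T` alone
(`exists_equivariant_factorization`, `exists_ricci_factorization`). Now `Φ` composed with `V ⊗ W →
Λ²V ⊗ End V` vanishes by (a), and `Φ ∘ Q` on the diagonal of `W` vanishes by (b). So the trace-free
Ricci tensor is zero (`tfRic_eq_zero`).

No averaging over `G` is needed, and `G` need not be closed: all representations here carry an
invariant inner product, and `∑ bᵢ ⊗ bᵢ` for an orthonormal basis is an invariant tensor. This gives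
equivariant projections and turns the vanishing of invariants into the vanishing of equivariant
maps.

Local constancy of `λ` is Schur's lemma: the second Bianchi identity, contracted twice, reads `(n -
2) dλ = 0` (`eq_zero_of_contracted_bianchi`). That `λ` is a function on `M` follows because the
curvature in a given frame does not depend on the chart, and `Ric = λ g` fixes `λ` when `n > 0`. -/

namespace GStructures

noncomputable section

/-! ### Orthogonal representations: invariant tensors, projections, equivariant factorization. -/

section InvariantForms

variable {H : Type*} [Group H] {E : Type*} [AddCommMonoid E] [Module ℝ E]
  {F : Type*} [AddCommMonoid F] [Module ℝ F]

/-- `B` is an inner product on `E` that is invariant under the representation `ρ`. -/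
structure IsInvariantInner (ρ : Representation ℝ H E) (B : E →ₗ[ℝ] E →ₗ[ℝ] ℝ) : Prop where
  symm : ∀ x y, B x y = B y x
  pos : ∀ x, x ≠ 0 → 0 < B x x
  inv : ∀ h x y, B (ρ h x) (ρ h y) = B x y

/-- `b` is an orthonormal basis with respect to `B`. -/
structure IsOrthonormalBasis {ι : Type*} [Fintype ι] [DecidableEq ι] (B : E →ₗ[ℝ] E →ₗ[ℝ] ℝ)
    (b : ι → E) : Prop where
  inner_eq : ∀ i j, B (b i) (b j) = if i = j then 1 else 0
  expand : ∀ x : E, ∑ i, B x (b i) • b i = x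

/-- The form `B` itself is installed as the inner product of `E`, so that the standard orthonormal
basis is orthonormal for `B`. -/
lemma IsInvariantInner.exists_orthonormal [Module.Finite ℝ E] {ρ : Representation ℝ H E}
    {B : E →ₗ[ℝ] E →ₗ[ℝ] ℝ} (hB : IsInvariantInner ρ B) :
    ∃ b : Fin (Module.finrank ℝ E) → E, IsOrthonormalBasis B b := by
  let _ : AddCommGroup E := Module.addCommMonoidToAddCommGroup ℝ
  let core : InnerProductSpace.Core ℝ E :=
    { inner := fun x y => B x y
      conj_inner_symm := fun x y => by simpa using hB.symm y x
      re_inner_nonneg := fun x => by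
        by_cases h : x = 0
        · simp [h]
        · simpa using (hB.pos x h).le
      add_left := fun x y z => by simp
      smul_left := fun x y r => by simp
      definite := fun x hx => by
        by_contra h
        exact (hB.pos x h).ne' hx }
  let _ : NormedAddCommGroup E := core.toNormedAddCommGroup
  let _ : InnerProductSpace ℝ E := InnerProductSpace.ofCore core.toCore
  have key : ∀ x y : E, inner ℝ x y = B x y := fun _ _ => rfl
  let b := stdOrthonormalBasis ℝ E
  refine ⟨b, fun i j => ?_, ?_⟩
  · rw [← key]
    exact orthonormal_iff_ite.mp b.orthonormal i j
  · intro x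
    conv_rhs => rw [← b.sum_repr' x]
    refine Finset.sum_congr rfl fun i _ => ?_
    rw [← key, real_inner_comm]

lemma IsInvariantInner.apply_left {ρ : Representation ℝ H E}
    {B : E →ₗ[ℝ] E →ₗ[ℝ] ℝ} (hB : IsInvariantInner ρ B) (h : H) (x y : E) :
    B (ρ h x) y = B x (ρ h⁻¹ y) := by
  rw [← hB.inv h x, ρ.self_inv_apply]

/-- The canonical element of `E ⊗ E` is invariant. -/
lemma IsInvariantInner.sum_apply {ι : Type*} [Fintype ι] [DecidableEq ι] {ρ : Representation ℝ H E}
    {B : E →ₗ[ℝ] E →ₗ[ℝ] ℝ} (hB : IsInvariantInner ρ B) {b : ι → E} (hb : IsOrthonormalBasis B b)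
    (β : E →ₗ[ℝ] E →ₗ[ℝ] F) (h : H) :
    ∑ i, β (ρ h (b i)) (ρ h (b i)) = ∑ i, β (b i) (b i) := by
  -- Expand only the first argument in the basis. After exchanging the sums, the coefficients
  -- reassemble the second argument as `ρ h (ρ h⁻¹ (b j)) = b j`.
  have h1 : ∀ i, β (ρ h (b i)) (ρ h (b i)) =
      ∑ j, β (b j) (B (b i) (ρ h⁻¹ (b j)) • ρ h (b i)) := by
    intro i
    have h2 := congrArg (fun y => β y (ρ h (b i))) (hb.expand (ρ h (b i)))
    simp only [map_sum, LinearMap.sum_apply, map_smul, LinearMap.smul_apply] at h2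
    rw [← h2]
    refine Finset.sum_congr rfl fun j _ => ?_
    rw [map_smul, hB.apply_left]
  simp_rw [h1]
  rw [Finset.sum_comm]
  refine Finset.sum_congr rfl fun j _ => ?_
  rw [← map_sum]
  congr 1
  have h2 := hb.expand (ρ h⁻¹ (b j))
  conv_rhs => rw [← ρ.self_inv_apply h (b j), ← h2]
  rw [map_sum]
  refine Finset.sum_congr rfl fun i _ => ?_
  rw [map_smul, hB.symm]

lemma IsInvariantInner.subrep {ρ : Representation ℝ H E} {B : E →ₗ[ℝ] E →ₗ[ℝ] ℝ}
    (hB : IsInvariantInner ρ B) (K : Subrepresentation ρ) :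
    IsInvariantInner K.toRepresentation (B.domRestrict₁₂ K.toSubmodule K.toSubmodule) where
  symm x y := hB.symm _ _
  pos x hx := hB.pos _ (by simpa using hx)
  inv h x y := hB.inv h _ _

/-- The inner product on `Hom(E, F)`. -/
def homForm {ι : Type*} [Fintype ι] (b : ι → E) (C : F →ₗ[ℝ] F →ₗ[ℝ] ℝ) :
    (E →ₗ[ℝ] F) →ₗ[ℝ] (E →ₗ[ℝ] F) →ₗ[ℝ] ℝ :=
  ∑ i, C.compl₁₂ (LinearMap.applyₗ (b i)) (LinearMap.applyₗ (b i))

lemma homForm_apply {ι : Type*} [Fintype ι] (b : ι → E) (C : F →ₗ[ℝ] F →ₗ[ℝ] ℝ)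
    (f g : E →ₗ[ℝ] F) : homForm b C f g = ∑ i, C (f (b i)) (g (b i)) := by
  simp [homForm]

/-- This is the Hilbert–Schmidt product. Moving `f` and `g` by `h` amounts to moving the basis by
`h⁻¹`, which does not change the sum by `IsInvariantInner.sum_apply`. -/
lemma IsInvariantInner.linHom {ι : Type*} [Fintype ι] [DecidableEq ι] {ρ : Representation ℝ H E}
    {σ : Representation ℝ H F}
    {B : E →ₗ[ℝ] E →ₗ[ℝ] ℝ} (hB : IsInvariantInner ρ B) {b : ι → E} (hb : IsOrthonormalBasis B b)
    {C : F →ₗ[ℝ] F →ₗ[ℝ] ℝ} (hC : IsInvariantInner σ C) :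
    IsInvariantInner (Representation.linHom ρ σ) (homForm b C) where
  symm f g := by simp_rw [homForm_apply, hC.symm]
  pos f hf := by
    rw [homForm_apply]
    have nn : ∀ y, 0 ≤ C y y := fun y => by
      by_cases h : y = 0
      · simp [h]
      · exact (hC.pos y h).le
    refine lt_of_le_of_ne (Finset.sum_nonneg fun i _ => nn _) fun h0 => hf ?_
    have h1 := (Finset.sum_eq_zero_iff_of_nonneg fun i _ => nn (f (b i))).mp h0.symm
    have h2 : ∀ i, f (b i) = 0 := fun i => by
      by_contra h
      exact (hC.pos _ h).ne' (h1 i (Finset.mem_univ i))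
    ext x
    rw [← hb.expand x]
    simp [h2]
  inv h f g := by
    simp_rw [homForm_apply, Representation.linHom_apply, LinearMap.comp_apply, hC.inv]
    exact hB.sum_apply hb (C.compl₁₂ f g) h⁻¹

/-- The equivariant projection onto an invariant subspace. -/
lemma IsInvariantInner.exists_projection {ρ : Representation ℝ H E}
    {B : E →ₗ[ℝ] E →ₗ[ℝ] ℝ} (hB : IsInvariantInner ρ B) (K : Subrepresentation ρ)
    [Module.Finite ℝ K.toSubmodule] :
    ∃ P : E →ₗ[ℝ] E, (∀ x, P x ∈ K.toSubmodule) ∧ (∀ x ∈ K.toSubmodule, P x = x) ∧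
      ∀ h x, P (ρ h x) = ρ h (P x) := by
  obtain ⟨b, hb⟩ := (hB.subrep K).exists_orthonormal
  have happ : ∀ x, (∑ i, (B.flip (b i : E)).smulRight (b i : E)) x
      = ∑ i, B x (b i) • (b i : E) := fun x => by simp
  refine ⟨∑ i, (B.flip (b i : E)).smulRight (b i : E), fun x => ?_, fun x hx => ?_, fun h x => ?_⟩
  · rw [happ]
    exact Submodule.sum_mem _ fun i _ => Submodule.smul_mem _ _ (b i).2
  · rw [happ]
    have := congrArg Subtype.val (hb.expand ⟨x, hx⟩)
    rw [AddSubmonoidClass.coe_finsetSum] at this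
    exact this
  · rw [happ, happ, map_sum]
    have h1 := (hB.subrep K).sum_apply hb
      ((LinearMap.lsmul ℝ E ∘ₗ B (ρ h x)).compl₁₂ K.toSubmodule.subtype K.toSubmodule.subtype) h
    refine Eq.trans h1.symm (Finset.sum_congr rfl fun i _ => ?_)
    change B (ρ h x) (ρ h (b i)) • ρ h (b i) = _
    rw [hB.inv, map_smul]

lemma finite_submodule [Module.Finite ℝ E] (K : Submodule ℝ E) : Module.Finite ℝ K := by
  let _ : AddCommGroup E := Module.addCommMonoidToAddCommGroup ℝ
  infer_instance

/-- An equivariant linear map between orthogonal representations has an equivariant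
pseudo-inverse. -/
lemma exists_equivariant_pseudoinverse [Module.Finite ℝ E] [Module.Finite ℝ F]
    {ρ : Representation ℝ H E} {σ : Representation ℝ H F}
    {B : E →ₗ[ℝ] E →ₗ[ℝ] ℝ} (hB : IsInvariantInner ρ B)
    {C : F →ₗ[ℝ] F →ₗ[ℝ] ℝ} (hC : IsInvariantInner σ C)
    (T : E →ₗ[ℝ] F) (hT : ∀ h x, T (ρ h x) = σ h (T x)) :
    ∃ S : F →ₗ[ℝ] E, (∀ h y, S (σ h y) = ρ h (S y)) ∧ ∀ x, T (S (T x)) = T x := by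
  let _ : AddCommGroup E := Module.addCommMonoidToAddCommGroup ℝ
  let _ : AddCommGroup F := Module.addCommMonoidToAddCommGroup ℝ
  let K : Subrepresentation ρ := ⟨LinearMap.ker T, fun h x hx => by
    rw [LinearMap.mem_ker] at hx ⊢; rw [hT, hx, map_zero]⟩
  let L : Subrepresentation σ := ⟨LinearMap.range T, fun h y hy => by
    obtain ⟨x, rfl⟩ := hy; exact ⟨ρ h x, hT h x⟩⟩
  obtain ⟨P, hP1, hP2, hP3⟩ := hB.exists_projection K
  obtain ⟨Q, hQ1, hQ2, hQ3⟩ := hC.exists_projection L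
  obtain ⟨S₁, hS₁⟩ := LinearMap.exists_rightInverse_of_surjective T.rangeRestrict
    (LinearMap.range_rangeRestrict T)
  obtain ⟨S₀, hS₀⟩ := LinearMap.exists_extend S₁
  have hS : ∀ x, T (S₀ (T x)) = T x := fun x => by
    have h1 := congrArg Subtype.val (LinearMap.congr_fun hS₁ ⟨T x, x, rfl⟩)
    have h2 := LinearMap.congr_fun hS₀ ⟨T x, x, rfl⟩
    simp only [LinearMap.comp_apply, Submodule.subtype_apply] at h2
    rw [h2]
    simpa using h1
  have hTP : ∀ x, T (P x) = 0 := fun x => hP1 x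
  -- `S₀` is an arbitrary linear solution of `T S₀ T = T`. Its failure to be equivariant on the
  -- range of `T` lies in the kernel of `T`, and `1 - P` kills that; `Q` reduces all of `F` to the
  -- range.
  refine ⟨(LinearMap.id - P) ∘ₗ S₀ ∘ₗ Q, fun h y => ?_, fun x => ?_⟩
  · obtain ⟨x, hx⟩ : ∃ x, T x = Q y := hQ1 y
    simp only [LinearMap.comp_apply, LinearMap.sub_apply, LinearMap.id_apply, hQ3, ← hx, ← hT]
    have hk : S₀ (T (ρ h x)) - ρ h (S₀ (T x)) ∈ K.toSubmodule := by
      change T _ = 0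
      rw [map_sub, hS, hT, hT, hS, sub_self]
    have := hP2 _ hk
    rw [map_sub, hP3] at this
    rw [map_sub]
    rw [sub_eq_sub_iff_sub_eq_sub, this.symm]
  · simp only [LinearMap.comp_apply, LinearMap.sub_apply, LinearMap.id_apply]
    rw [hQ2 (T x) ⟨x, rfl⟩, map_sub, hTP, sub_zero, hS]

/-- If `t` vanishes on the kernel of `T` in `L`, then on the kernel of `T` the value of `t` at
`x + s`, with `s` in `L`, is an equivariant linear function of `x`. -/
lemma exists_equivariant_factorization [Module.Finite ℝ E]
    {ρ : Representation ℝ H E} {σ : Representation ℝ H F}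
    {B : E →ₗ[ℝ] E →ₗ[ℝ] ℝ} (hB : IsInvariantInner ρ B)
    (T : E →ₗ[ℝ] E) (hT : ∀ h x, T (ρ h x) = ρ h (T x))
    (t : E →ₗ[ℝ] F) (ht : ∀ h x, t (ρ h x) = σ h (t x))
    (L : Subrepresentation ρ) (hL : ∀ x ∈ L.toSubmodule, T x = 0 → t x = 0) :
    ∃ Φ : E →ₗ[ℝ] F, (∀ h x, Φ (ρ h x) = σ h (Φ x)) ∧
      ∀ x, ∀ s ∈ L.toSubmodule, T (x + s) = 0 → t (x + s) = Φ x := by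
  let _ : AddCommGroup E := Module.addCommMonoidToAddCommGroup ℝ
  let _ : AddCommGroup F := Module.addCommMonoidToAddCommGroup ℝ
  obtain ⟨P, hP1, hP2, hP3⟩ := hB.exists_projection L
  obtain ⟨S, hS, hTST⟩ := exists_equivariant_pseudoinverse hB hB (T ∘ₗ P) (fun h x => by
      rw [LinearMap.comp_apply, LinearMap.comp_apply, hP3, hT])
  -- Here `S` is a pseudo-inverse of `T` restricted to `L`. From `T s = -T x`, the vector `-P (S (T
  -- x))` of `L` has the same image under `T` as `s`, and so the same value of `t`.
  refine ⟨t ∘ₗ (LinearMap.id - P ∘ₗ S ∘ₗ T), fun h x => ?_, fun x s hs hx => ?_⟩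
  · simp only [LinearMap.comp_apply, LinearMap.sub_apply, LinearMap.id_apply, hT, hS, hP3,
      ← map_sub, ht]
  · have h1 := hTST s
    simp only [LinearMap.comp_apply, hP2 s hs] at h1
    have h2 := hL (s - P (S (T s))) (L.toSubmodule.sub_mem hs (hP1 _)) (by
      rw [map_sub, h1, sub_self])
    have h3 : T s = - T x := eq_neg_of_add_eq_zero_right (by rw [← map_add, hx])
    rw [map_sub, h3, map_neg, map_neg, map_neg, sub_neg_eq_add] at h2
    simp only [LinearMap.comp_apply, LinearMap.sub_apply, LinearMap.id_apply, map_sub, map_add,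
      eq_neg_of_add_eq_zero_left h2]
    abel

end InvariantForms

/-! ### Vanishing of invariants implies vanishing of equivariant linear, bilinear and quadratic
maps. -/

section Schur

variable {n : ℕ} {G : Subgroup (Vec n ≃ₗᵢ[ℝ] Vec n)}
  {E : Type*} [AddCommMonoid E] [Module ℝ E]
  {E' : Type*} [AddCommMonoid E'] [Module ℝ E']
  {F : Type*} [AddCommMonoid F] [Module ℝ F]

/-- The tensor `∑ bᵢ ⊗ f bᵢ` is invariant, hence zero, and contracting its first factor with `b j`
recovers `f (b j)`. -/
lemma NoInvariants.linearMap_eq_zero [Module.Finite ℝ E]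
    {ρ : Representation ℝ G E} {σ : Representation ℝ G F} (h0 : NoInvariants G (ρ.tprod σ))
    {B : E →ₗ[ℝ] E →ₗ[ℝ] ℝ} (hB : IsInvariantInner ρ B)
    (f : E →ₗ[ℝ] F) (hf : ∀ h x, f (ρ h x) = σ h (f x)) : f = 0 := by
  obtain ⟨b, hb⟩ := hB.exists_orthonormal
  have ht := h0 (∑ i, b i ⊗ₜ[ℝ] f (b i)) fun h => by
    have := hB.sum_apply hb ((TensorProduct.mk ℝ E F).compl₂ f) h
    simpa [map_sum, Representation.tprod_apply, hf] using this
  have hj : ∀ j, f (b j) = 0 := fun j => by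
    have := congrArg (TensorProduct.lift (LinearMap.lsmul ℝ F ∘ₗ B (b j))) ht
    simpa [map_sum, hb.inner_eq] using this
  ext x
  rw [← hb.expand x]
  simp [hj]

/-- The same argument with `∑ (bᵢ ⊗ b'ₖ) ⊗ f(bᵢ, b'ₖ)`; invariance is checked by absorbing `h` first
in the `E'` slots and then in the `E` slots. -/
lemma NoInvariants.bilinear_eq_zero [Module.Finite ℝ E] [Module.Finite ℝ E']
    {ρ : Representation ℝ G E} {ρ' : Representation ℝ G E'} {σ : Representation ℝ G F}
    (h0 : NoInvariants G ((ρ.tprod ρ').tprod σ))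
    {B : E →ₗ[ℝ] E →ₗ[ℝ] ℝ} (hB : IsInvariantInner ρ B)
    {B' : E' →ₗ[ℝ] E' →ₗ[ℝ] ℝ} (hB' : IsInvariantInner ρ' B')
    (f : E →ₗ[ℝ] E' →ₗ[ℝ] F) (hf : ∀ h x y, f (ρ h x) (ρ' h y) = σ h (f x y))
    (x : E) (y : E') : f x y = 0 := by
  obtain ⟨b, hb⟩ := hB.exists_orthonormal
  obtain ⟨b', hb'⟩ := hB'.exists_orthonormal
  let t := TensorProduct.mk ℝ (E ⊗[ℝ] E') F
  let β : E' → E →ₗ[ℝ] E →ₗ[ℝ] (E ⊗[ℝ] E') ⊗[ℝ] F := fun y =>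
    t.compl₁₂ ((TensorProduct.mk ℝ E E').flip y) (f.flip y)
  let β' : E → E' →ₗ[ℝ] E' →ₗ[ℝ] (E ⊗[ℝ] E') ⊗[ℝ] F := fun x =>
    t.compl₁₂ (TensorProduct.mk ℝ E E' x) (f x)
  have ht := h0 (∑ i, ∑ k, (b i ⊗ₜ[ℝ] b' k) ⊗ₜ[ℝ] f (b i) (b' k)) fun h => by
    calc _ = ∑ i, ∑ k, β' (ρ h (b i)) (ρ' h (b' k)) (ρ' h (b' k)) := by
          simp [map_sum, Representation.tprod_apply, hf, β', t]
      _ = ∑ i, ∑ k, β' (ρ h (b i)) (b' k) (b' k) :=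
          Finset.sum_congr rfl fun i _ => hB'.sum_apply hb' _ h
      _ = ∑ k, ∑ i, β (b' k) (ρ h (b i)) (ρ h (b i)) := Finset.sum_comm
      _ = ∑ k, ∑ i, β (b' k) (b i) (b i) :=
          Finset.sum_congr rfl fun k _ => hB.sum_apply hb _ h
      _ = _ := Finset.sum_comm
  have hj : ∀ j l, f (b j) (b' l) = 0 := fun j l => by
    have := congrArg (TensorProduct.lift (LinearMap.lsmul ℝ F ∘ₗ
      TensorProduct.lift ((LinearMap.mul ℝ ℝ).compl₁₂ (B (b j)) (B' (b' l))))) ht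
    simpa [map_sum, hb.inner_eq, hb'.inner_eq] using this
  rw [← hb.expand x, ← hb'.expand y]
  simp [hj]

/-- `x ⊗ y + y ⊗ x`, as an element of the symmetric square. -/
def symProd (ρ : Representation ℝ G E) :
    E →ₗ[ℝ] E →ₗ[ℝ] (symSquare G ρ).toSubmodule :=
  LinearMap.mk₂ ℝ (fun x y => ⟨x ⊗ₜ y + y ⊗ₜ x, by
      change TensorProduct.comm ℝ E E (x ⊗ₜ y + y ⊗ₜ x) = x ⊗ₜ y + y ⊗ₜ x
      simp [add_comm]⟩)
    (fun x x' y => Subtype.ext (by simp [TensorProduct.add_tmul, TensorProduct.tmul_add]; abel))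
    (fun c x y => Subtype.ext (by simp [TensorProduct.smul_tmul']))
    (fun x x' y => Subtype.ext (by simp [TensorProduct.add_tmul, TensorProduct.tmul_add]; abel))
    (fun c x y => Subtype.ext (by simp [TensorProduct.smul_tmul']))

lemma coe_symProd (ρ : Representation ℝ G E) (x y : E) :
    (symProd ρ x y : E ⊗[ℝ] E) = x ⊗ₜ y + y ⊗ₜ x := rfl

lemma symProd_apply (ρ : Representation ℝ G E) (h : G) (x y : E) :
    (symSquare G ρ).toRepresentation h (symProd ρ x y) = symProd ρ (ρ h x) (ρ h y) :=
  Subtype.ext (by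
    change TensorProduct.map (ρ h) (ρ h) (x ⊗ₜ y + y ⊗ₜ x) = _
    rw [coe_symProd, map_add, TensorProduct.map_tmul, TensorProduct.map_tmul])

/-- Of the symmetric square only two things matter: an equivariant symmetric product `s` with values
in `S`, and a linear map `r` that reads it as a tensor. The invariant element is built from the
symmetrization of `f`, which has the same diagonal as `2f`. -/
lemma quadratic_eq_zero_of_noInvariants [Module.Finite ℝ E]
    {S : Type*} [AddCommMonoid S] [Module ℝ S]
    {ρ : Representation ℝ G E} {κ : Representation ℝ G S} {σ : Representation ℝ G F}
    (s : E →ₗ[ℝ] E →ₗ[ℝ] S) (hs : ∀ h x y, κ h (s x y) = s (ρ h x) (ρ h y))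
    (r : S →ₗ[ℝ] E ⊗[ℝ] E) (hr : ∀ x y, r (s x y) = x ⊗ₜ y + y ⊗ₜ x)
    (h0 : NoInvariants G (κ.tprod σ))
    {B : E →ₗ[ℝ] E →ₗ[ℝ] ℝ} (hB : IsInvariantInner ρ B)
    (f : E →ₗ[ℝ] E →ₗ[ℝ] F) (hf : ∀ h x y, f (ρ h x) (ρ h y) = σ h (f x y))
    (x : E) : f x x = 0 := by
  obtain ⟨b, hb⟩ := hB.exists_orthonormal
  let fs := f + f.flip
  have hfs : ∀ h x y, fs (ρ h x) (ρ h y) = σ h (fs x y) := fun h x y => by simp [fs, hf]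
  let t := TensorProduct.mk ℝ S F
  let β : E → E →ₗ[ℝ] E →ₗ[ℝ] S ⊗[ℝ] F := fun y => t.compl₁₂ (s.flip y) (fs.flip y)
  let β' : E → E →ₗ[ℝ] E →ₗ[ℝ] S ⊗[ℝ] F := fun x => t.compl₁₂ (s x) (fs x)
  have ht := h0 (∑ i, ∑ k, s (b i) (b k) ⊗ₜ[ℝ] fs (b i) (b k)) fun h => by
    calc _ = ∑ i, ∑ k, β' (ρ h (b i)) (ρ h (b k)) (ρ h (b k)) := by
          simp only [map_sum, Representation.tprod_apply, TensorProduct.map_tmul, hs, ← hfs]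
          rfl
      _ = ∑ i, ∑ k, β' (ρ h (b i)) (b k) (b k) :=
          Finset.sum_congr rfl fun i _ => hB.sum_apply hb _ h
      _ = ∑ k, ∑ i, β (b k) (ρ h (b i)) (ρ h (b i)) := Finset.sum_comm
      _ = ∑ k, ∑ i, β (b k) (b i) (b i) :=
          Finset.sum_congr rfl fun k _ => hB.sum_apply hb _ h
      _ = _ := Finset.sum_comm
  have hj : ∀ j l, fs (b j) (b l) = 0 := fun j l => by
    -- Contracting with `b j ⊗ b l` picks out the terms `(j, l)` and `(l, j)`; they are equal
    -- because `fs` is symmetric, so the result is `2 • fs (b j) (b l)`.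
    have := congrArg (TensorProduct.lift (LinearMap.lsmul ℝ F ∘ₗ
      TensorProduct.lift ((LinearMap.mul ℝ ℝ).compl₁₂ (B (b j)) (B (b l))) ∘ₗ r)) ht
    simp only [map_sum, TensorProduct.lift.tmul, LinearMap.comp_apply, hr,
      map_add, LinearMap.compl₁₂_apply, LinearMap.mul_apply', hb.inner_eq,
      LinearMap.lsmul_apply, map_zero, Finset.sum_add_distrib, LinearMap.add_apply] at this
    simp only [mul_ite, mul_one, mul_zero, ite_smul, one_smul, zero_smul,
      Finset.sum_ite_eq, Finset.mem_univ, if_true] at this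
    have hsym : fs (b l) (b j) = fs (b j) (b l) := by simp [fs, add_comm]
    simp only [Finset.sum_ite_irrel, Finset.sum_ite_eq, Finset.mem_univ, if_true,
      Finset.sum_const_zero, hsym, ← two_smul ℝ, smul_eq_zero, OfNat.ofNat_ne_zero,
        false_or] at this
    exact this
  have h2 : fs x x = 0 := by
    rw [← hb.expand x]
    simp [hj]
  simpa [fs, ← two_smul ℝ] using h2

lemma NoInvariants.quadratic_eq_zero [Module.Finite ℝ E]
    {ρ : Representation ℝ G E} {σ : Representation ℝ G F}
    (h0 : NoInvariants G ((symSquare G ρ).toRepresentation.tprod σ))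
    {B : E →ₗ[ℝ] E →ₗ[ℝ] ℝ} (hB : IsInvariantInner ρ B)
    (f : E →ₗ[ℝ] E →ₗ[ℝ] F) (hf : ∀ h x y, f (ρ h x) (ρ h y) = σ h (f x y))
    (x : E) : f x x = 0 :=
  quadratic_eq_zero_of_noInvariants (symProd ρ) (symProd_apply ρ)
    (symSquare G ρ).toSubmodule.subtype (fun _ _ => rfl) h0 hB f hf x

end Schur

/-! ### Invariant inner products on `V`, `End V`, `V ⊗ End V` and `V ⊗ V ⊗ End V`. -/

section StandardForms

variable {n : ℕ} (G : Subgroup (Vec n ≃ₗᵢ[ℝ] Vec n))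

/-- The standard basis. -/
def sb (i : Fin n) : Vec n := EuclideanSpace.single i 1

lemma sb_expand (x : Vec n) : ∑ i, inner ℝ x (sb i) • sb i = x := by
  conv_rhs => rw [← (EuclideanSpace.basisFun (Fin n) ℝ).sum_repr' x]
  simp [sb, real_inner_comm]

lemma isOrthonormalBasis_sb : IsOrthonormalBasis (innerₗ (Vec n)) (sb : Fin n → Vec n) where
  inner_eq i j := by
    have := orthonormal_iff_ite.mp (EuclideanSpace.basisFun (Fin n) ℝ).orthonormal i j
    simpa [sb] using this
  expand x := sb_expand x

lemma isInvariantInner_std : IsInvariantInner (stdRep G) (innerₗ (Vec n)) where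
  symm x y := real_inner_comm y x
  pos _ hx := real_inner_self_pos.mpr hx
  inv h x y := stdRep_inner G h x y

lemma isInvariantInner_end :
    IsInvariantInner (endRep G) (homForm sb (innerₗ (Vec n))) :=
  (isInvariantInner_std G).linHom isOrthonormalBasis_sb (isInvariantInner_std G)

lemma isInvariantInner_tensor :
    IsInvariantInner (tensorRep G) (homForm sb (homForm sb (innerₗ (Vec n)))) :=
  (isInvariantInner_std G).linHom isOrthonormalBasis_sb (isInvariantInner_end G)

lemma isInvariantInner_curv :
    IsInvariantInner (curvRep G) (homForm sb (homForm sb (homForm sb (innerₗ (Vec n))))) :=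
  (isInvariantInner_std G).linHom isOrthonormalBasis_sb (isInvariantInner_tensor G)

end StandardForms

/-! ### The infinitesimal action of `𝔤`, and the splitting `𝔤 ⊕ 𝔤^⊥`. -/

section LieAlgebra

open Topology Filter

/-- Difference quotients stay in the subspace, which is closed by finite dimension. The map `e` lets
the curve live in a normed space of continuous maps while the subspace lives in the space `L` of
plain linear maps. -/
lemma HasDerivAt.mem_of_forall_mem {N L : Type*} [NormedAddCommGroup N] [NormedSpace ℝ N]
    [FiniteDimensional ℝ N] [AddCommGroup L] [Module ℝ L] (e : N →ₗ[ℝ] L) (W : Submodule ℝ L)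
    {c : ℝ → N} {c' : N} {t₀ : ℝ} (hc : HasDerivAt c c' t₀) (hW : ∀ᶠ t in 𝓝 t₀, e (c t) ∈ W) :
    e c' ∈ W := by
  have hcl : IsClosed ((W.comap e : Submodule ℝ N) : Set N) :=
    (W.comap e).closed_of_finiteDimensional
  have ht := hasDerivAt_iff_tendsto_slope.mp hc
  refine hcl.mem_of_tendsto ht ?_
  filter_upwards [hW.filter_mono nhdsWithin_le_nhds] with t h
  change e (slope c t₀ t) ∈ W
  rw [slope_def_module, map_smul, map_sub]
  exact W.smul_mem _ (W.sub_mem h hW.self_of_nhds)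

lemma HasFDerivAt.mem_of_eventually_mem {N L D : Type*} [NormedAddCommGroup N] [NormedSpace ℝ N]
    [FiniteDimensional ℝ N] [AddCommGroup L] [Module ℝ L] [NormedAddCommGroup D] [NormedSpace ℝ D]
    (e : N →ₗ[ℝ] L) (W : Submodule ℝ L) {F : D → N} {F' : D →L[ℝ] N} {u : D}
    (hF : HasFDerivAt F F' u) (hW : ∀ᶠ v in 𝓝 u, e (F v) ∈ W) (a : D) : e (F' a) ∈ W := by
  have hl : HasDerivAt (fun t : ℝ => u + t • a) a 0 := by
    simpa using ((hasDerivAt_id (0 : ℝ)).smul_const a).const_add u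
  have hF' : HasFDerivAt F F' (u + (0 : ℝ) • a) := by simpa using hF
  refine HasDerivAt.mem_of_forall_mem e W (hF'.comp_hasDerivAt 0 hl) ?_
  have : Tendsto (fun t : ℝ => u + t • a) (𝓝 0) (𝓝 u) := by
    simpa using hl.continuousAt.tendsto
  exact this.eventually hW

variable {n : ℕ} {G : Subgroup (Vec n ≃ₗᵢ[ℝ] Vec n)}

lemma skew_of_mem_lieAlg {A : Vec n →ₗ[ℝ] Vec n} (hA : A ∈ lieAlg G) (v w : Vec n) :
    inner ℝ (A v) w = -inner ℝ v (A w) := by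
  obtain ⟨γ, -, hγG, hγ0, hγd⟩ := hA
  have hv := hγd.clm_apply (hasDerivAt_const 0 v)
  have hw := hγd.clm_apply (hasDerivAt_const 0 w)
  have h := hv.inner ℝ hw
  have hc : (fun t => inner ℝ (γ t v) (γ t w)) = fun _ => inner ℝ v w := by
    funext t
    obtain ⟨h, -, e⟩ := hγG t
    rw [e]
    exact h.inner_map_map v w
  rw [hc] at h
  have := h.unique (hasDerivAt_const _ _)
  simp [hγ0] at this
  linarith

lemma ringInverse_isoCLM (h : Vec n ≃ₗᵢ[ℝ] Vec n) :
    Ring.inverse (isoCLM h) = isoCLM h⁻¹ := by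
  let u : (Vec n →L[ℝ] Vec n)ˣ := ⟨isoCLM h, isoCLM h⁻¹, by ext1 v; exact h.apply_symm_apply v,
    by ext1 v; exact h.symm_apply_apply v⟩
  exact Ring.inverse_unit u

section Conjugation

variable {R : Type*} [NormedRing R] [NormedAlgebra ℝ R] [CompleteSpace R]
  {X : Type*} [NormedAddCommGroup X] [NormedSpace ℝ X] {γ : ℝ → R} {A : R}

lemma hasDerivAt_ringInverse_curve (h0 : γ 0 = 1) (hγ : HasDerivAt γ A 0) :
    HasDerivAt (fun t => Ring.inverse (γ t)) (-A) 0 := by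
  have h1 := hasFDerivAt_ringInverse (𝕜 := ℝ) (1 : Rˣ)
  have h2 : HasFDerivAt Ring.inverse
    (-ContinuousLinearMap.mulLeftRight ℝ R ↑(1 : Rˣ)⁻¹ ↑(1 : Rˣ)⁻¹) (γ 0) := by rw [h0]; exact h1
  exact (h2.comp_hasDerivAt 0 hγ).congr_deriv (by simp)

lemma hasDerivAt_conj (h0 : γ 0 = 1) (hγ : HasDerivAt γ A 0) (B : R) :
    HasDerivAt (fun t => γ t * B * Ring.inverse (γ t)) (A * B - B * A) 0 :=
  ((hγ.mul (hasDerivAt_const 0 B)).mul (hasDerivAt_ringInverse_curve h0 hγ)).congr_deriv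
    (by simp [h0, sub_eq_add_neg])

/-- The Leibniz rule for three factors. In use `R = End X`, `A' = A` and `δ` is the inverse of `γ`,
so that `ζ` is the action of `A` on `X ⊗ End X`. -/
lemma hasDerivAt_tensor_conj (h0 : γ 0 = 1) (hγ : HasDerivAt γ A 0) {δ : ℝ → X →L[ℝ] X}
    {A' : X →L[ℝ] X} (hδ0 : δ 0 = 1) (hδ : HasDerivAt δ (-A') 0)
    (ξ : X →L[ℝ] R) :
    ∃ ζ : X →L[ℝ] R, (∀ Y, ζ Y = A * ξ Y - ξ Y * A - ξ (A' Y)) ∧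
    HasDerivAt (fun t => (ContinuousLinearMap.mul ℝ R (γ t)).comp
      (((ContinuousLinearMap.mul ℝ R).flip (Ring.inverse (γ t))).comp (ξ.comp (δ t)))) ζ 0 := by
  have hi := hasDerivAt_ringInverse_curve h0 hγ
  have h1 := (ContinuousLinearMap.mul ℝ R).hasFDerivAt.comp_hasDerivAt 0 hγ
  have h2 := (ContinuousLinearMap.mul ℝ R).flip.hasFDerivAt.comp_hasDerivAt 0 hi
  refine ⟨_, fun Y => ?_, h1.clm_comp (h2.clm_comp ((hasDerivAt_const 0 ξ).clm_comp hδ))⟩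
  simp [h0, hδ0]
  abel

end Conjugation

section GenericSpace

variable {V : Type*} [NormedAddCommGroup V] [NormedSpace ℝ V]

/-- Forget the continuity of a linear map into the space of endomorphisms. -/
def toLin₂ : (V →L[ℝ] V →L[ℝ] V) →ₗ[ℝ] (V →ₗ[ℝ] V →ₗ[ℝ] V) where
  toFun f := ContinuousLinearMap.coeLM ℝ ∘ₗ (f : V →ₗ[ℝ] V →L[ℝ] V)
  map_add' _ _ := rfl
  map_smul' _ _ := rfl

@[simp] lemma toLin₂_apply (f : V →L[ℝ] V →L[ℝ] V) (X Y : V) : toLin₂ f X Y = f X Y := rfl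

variable [FiniteDimensional ℝ V]

lemma exists_toLin₂ (f : V →ₗ[ℝ] V →ₗ[ℝ] V) : ∃ g, toLin₂ g = f :=
  ⟨LinearMap.toContinuousLinearMap (LinearMap.toContinuousLinearMap.toLinearMap ∘ₗ f), rfl⟩

lemma conj_velocity_mem (L : Submodule ℝ (V →ₗ[ℝ] V)) {γ δ : ℝ → V →L[ℝ] V} {A : V →L[ℝ] V}
    (hγ0 : γ 0 = ContinuousLinearMap.id ℝ V) (hγ : HasDerivAt γ A 0)
    (hδ : ∀ t, δ t = Ring.inverse (γ t)) (B : V →ₗ[ℝ] V)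
    (hB : ∀ t, ((γ t : V →ₗ[ℝ] V) ∘ₗ B ∘ₗ (δ t : V →ₗ[ℝ] V)) ∈ L) :
    (A : V →ₗ[ℝ] V) ∘ₗ B - B ∘ₗ (A : V →ₗ[ℝ] V) ∈ L := by
  have : CompleteSpace V := FiniteDimensional.complete ℝ V
  have hc := hasDerivAt_conj hγ0 hγ (LinearMap.toContinuousLinearMap B)
  refine HasDerivAt.mem_of_forall_mem (ContinuousLinearMap.coeLM ℝ) L hc
    (Eventually.of_forall fun t => ?_)
  rw [← hδ]
  exact hB t

lemma exists_hasDerivAt_tensor {γ : ℝ → V →L[ℝ] V}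
    {A : V →L[ℝ] V} (hγ0 : γ 0 = ContinuousLinearMap.id ℝ V) (hγ : HasDerivAt γ A 0)
    (ξ : V →L[ℝ] V →L[ℝ] V) :
    ∃ (c : ℝ → V →L[ℝ] V →L[ℝ] V) (ζ : V →L[ℝ] V →L[ℝ] V),
      (∀ t Y Z, c t Y Z = γ t (ξ (Ring.inverse (γ t) Y) (Ring.inverse (γ t) Z))) ∧
      (∀ Y Z, ζ Y Z = A (ξ Y Z) - ξ Y (A Z) - ξ (A Y) Z) ∧ HasDerivAt c ζ 0 := by
  have : CompleteSpace V := FiniteDimensional.complete ℝ V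
  have hi := hasDerivAt_ringInverse_curve hγ0 hγ
  have h0 : Ring.inverse (γ 0) = 1 := by
    rw [hγ0]; exact Ring.inverse_one _
  obtain ⟨ζ, hζ, hc⟩ := hasDerivAt_tensor_conj hγ0 hγ h0 hi ξ
  exact ⟨_, ζ, fun _ _ _ => rfl, fun Y Z => by rw [hζ]; rfl, hc⟩

lemma tensor_velocity_mem (W : Submodule ℝ (V →ₗ[ℝ] V →ₗ[ℝ] V)) {γ δ : ℝ → V →L[ℝ] V}
    {A : V →L[ℝ] V} (hγ0 : γ 0 = ContinuousLinearMap.id ℝ V) (hγ : HasDerivAt γ A 0)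
    (hδ : ∀ t, δ t = Ring.inverse (γ t)) (ξ : V →ₗ[ℝ] V →ₗ[ℝ] V)
    (hξ : ∀ t, ∃ ζ ∈ W, ∀ Y Z, ζ Y Z = γ t (ξ (δ t Y) (δ t Z)))
    {ζ : V →ₗ[ℝ] V →ₗ[ℝ] V}
    (hζ : ∀ Y Z, ζ Y Z = A (ξ Y Z) - ξ Y (A Z) - ξ (A Y) Z) : ζ ∈ W := by
  obtain ⟨ξ', rfl⟩ := exists_toLin₂ ξ
  obtain ⟨c, ζ', hc, hζ', hd⟩ := exists_hasDerivAt_tensor hγ0 hγ ξ'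
  have h2 : toLin₂ ζ' = ζ := LinearMap.ext₂ fun Y Z => by
    rw [hζ, toLin₂_apply, hζ']; rfl
  rw [← h2]
  refine HasDerivAt.mem_of_forall_mem (N := V →L[ℝ] V →L[ℝ] V) toLin₂ W hd
    (Eventually.of_forall fun t => ?_)
  obtain ⟨η, hη, e⟩ := hξ t
  have h3 : toLin₂ (c t) = η := LinearMap.ext₂ fun Y Z => by
    rw [e, hδ, toLin₂_apply, hc]; rfl
  rw [h3]
  exact hη

end GenericSpace

/-- The bracket is the velocity at `0` of `γ B γ⁻¹`, a curve in the subspace `𝔤` since `G` acts on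
`𝔤` by conjugation. -/
lemma bracket_mem_lieAlg {A B : Vec n →ₗ[ℝ] Vec n} (hA : A ∈ lieAlg G) (hB : B ∈ lieAlg G) :
    A ∘ₗ B - B ∘ₗ A ∈ lieAlg G := by
  obtain ⟨γ, -, hγG, hγ0, hγd⟩ := hA
  refine conj_velocity_mem (lieAlg G) hγ0 hγd (fun _ => rfl) B fun t => ?_
  obtain ⟨h, hh, e⟩ := hγG t
  have h1 := endRep_mem_lieAlg G ⟨h, hh⟩ hB
  rw [e, ringInverse_isoCLM]
  exact h1

/-- A `G`-submodule is a `𝔤`-submodule: `ζ = A · ξ` is the velocity of the curve `γ(t) · ξ` in `W`.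
-/
lemma lieAlg_smul_mem (W : Subrepresentation (tensorRep G)) {A : Vec n →ₗ[ℝ] Vec n}
    (hA : A ∈ lieAlg G) {ξ : Vec n →ₗ[ℝ] Vec n →ₗ[ℝ] Vec n} (hξ : ξ ∈ W.toSubmodule)
    {ζ : Vec n →ₗ[ℝ] Vec n →ₗ[ℝ] Vec n}
    (hζ : ∀ Y Z, ζ Y Z = A (ξ Y Z) - ξ Y (A Z) - ξ (A Y) Z) : ζ ∈ W.toSubmodule := by
  obtain ⟨γ, -, hγG, hγ0, hγd⟩ := hA
  refine tensor_velocity_mem W.toSubmodule hγ0 hγd (fun _ => rfl) ξ (fun t => ?_) hζ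
  obtain ⟨h, hh, e⟩ := hγG t
  refine ⟨_, W.apply_mem_toSubmodule ⟨h, hh⟩ hξ, fun Y Z => ?_⟩
  rw [e, ringInverse_isoCLM]
  rfl

/-- For skew `A` one has `tr A² = -∑ ‖A eᵢ‖²`. -/
lemma trace_sq_of_skew {A : Vec n →ₗ[ℝ] Vec n}
    (hA : ∀ v w, inner ℝ (A v) w = -inner ℝ v (A w)) (h0 : LinearMap.trace ℝ (Vec n) (A ∘ₗ A) = 0) :
    A = 0 := by
  have h1 := LinearMap.trace_eq_sum_inner (A ∘ₗ A) (EuclideanSpace.basisFun (Fin n) ℝ)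
  rw [h0] at h1
  have h2 : ∑ i, ‖A (sb i)‖ ^ 2 = 0 := by
    rw [← neg_eq_zero, ← Finset.sum_neg_distrib, h1]
    refine Finset.sum_congr rfl fun i _ => ?_
    have := hA (sb i) (A (sb i))
    rw [← real_inner_self_eq_norm_sq, this, neg_neg]
    simp [sb]
  rw [Finset.sum_eq_zero_iff_of_nonneg (fun i _ => by positivity)] at h2
  ext1 x
  rw [← sb_expand x]
  rw [map_sum, LinearMap.zero_apply]
  refine Finset.sum_eq_zero fun i hi => ?_
  have := h2 i hi
  simp only [ne_eq, OfNat.ofNat_ne_zero, not_false_eq_true, pow_eq_zero_iff, norm_eq_zero] at this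
  rw [map_smul, this, smul_zero]

lemma disjoint_lieAlg_lieAlgPerp : Disjoint (lieAlg G) (lieAlgPerp G) := by
  rw [Submodule.disjoint_def]
  intro A hA hA'
  exact trace_sq_of_skew hA'.1 (hA'.2 A hA)

/-- There is a linear map that is the identity on `𝔤^⊥` and zero on `𝔤`. -/
lemma exists_perp_projection (G : Subgroup (Vec n ≃ₗᵢ[ℝ] Vec n)) :
    ∃ π : (Vec n →L[ℝ] Vec n) →ₗ[ℝ] (Vec n →L[ℝ] Vec n),
      ∀ A B : Vec n →L[ℝ] Vec n, (A : Vec n →ₗ[ℝ] Vec n) ∈ lieAlgPerp G →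
        (B : Vec n →ₗ[ℝ] Vec n) ∈ lieAlg G → π (A + B) = A := by
  -- `q` is any complement of `𝔤^⊥` in `End V` that contains `𝔤`. Neither orthogonality nor
  -- equivariance of the projection is required.
  obtain ⟨q, hq, hc⟩ := (disjoint_lieAlg_lieAlgPerp (G := G)).exists_isCompl
  let c : (Vec n →L[ℝ] Vec n) ≃ₗ[ℝ] (Vec n →ₗ[ℝ] Vec n) := LinearMap.toContinuousLinearMap.symm
  let p := (lieAlgPerp G).projection q hc.symm
  refine ⟨c.symm.toLinearMap ∘ₗ p ∘ₗ c.toLinearMap, fun A B hA hB => ?_⟩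
  have h1 : p (c A) = c A := Submodule.projection_apply_of_mem_left hc.symm hA
  have h2 : p (c B) = 0 := (Submodule.projection_apply_eq_zero_iff hc.symm).mpr (hq hB)
  change c.symm (p (c (A + B))) = A
  rw [map_add, map_add, h1, h2, add_zero]
  exact c.symm_apply_apply A

end LieAlgebra

/-! ### Bianchi map, Ricci contraction and the two ways in which `W` produces curvature tensors. -/

section AlgebraicCurvature

variable {n : ℕ}

/-- Exchange of the two arguments of a bilinear map. -/
def swapArgs (F : Type*) [AddCommGroup F] [Module ℝ F] :
    (Vec n →ₗ[ℝ] Vec n →ₗ[ℝ] F) →ₗ[ℝ] (Vec n →ₗ[ℝ] Vec n →ₗ[ℝ] F) where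
  toFun b := b.flip
  map_add' _ _ := rfl
  map_smul' _ _ := rfl

/-- Cyclic permutation of the three arguments of `R`. -/
def cyc : (Vec n →ₗ[ℝ] Vec n →ₗ[ℝ] Vec n →ₗ[ℝ] Vec n) →ₗ[ℝ]
    (Vec n →ₗ[ℝ] Vec n →ₗ[ℝ] Vec n →ₗ[ℝ] Vec n) where
  toFun R := (swapArgs (Vec n) ∘ₗ R).flip
  map_add' _ _ := rfl
  map_smul' _ _ := rfl

/-- The Bianchi map. -/
def bianchi : (Vec n →ₗ[ℝ] Vec n →ₗ[ℝ] Vec n →ₗ[ℝ] Vec n) →ₗ[ℝ]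
    (Vec n →ₗ[ℝ] Vec n →ₗ[ℝ] Vec n →ₗ[ℝ] Vec n) :=
  LinearMap.id + cyc + cyc ∘ₗ cyc

lemma bianchi_apply (R : Vec n →ₗ[ℝ] Vec n →ₗ[ℝ] Vec n →ₗ[ℝ] Vec n) (X Y Z : Vec n) :
    bianchi R X Y Z = R X Y Z + R Y Z X + R Z X Y := rfl

/-- The Ricci contraction. -/
def ric : (Vec n →ₗ[ℝ] Vec n →ₗ[ℝ] Vec n →ₗ[ℝ] Vec n) →ₗ[ℝ] (Vec n →ₗ[ℝ] Vec n →ₗ[ℝ] ℝ) where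
  toFun R := ∑ i, (R (sb i)).compr₂ (innerₗ (Vec n) (sb i))
  map_add' R S := LinearMap.ext₂ fun Y Z => by
    simp [LinearMap.sum_apply, inner_add_right, Finset.sum_add_distrib]
  map_smul' c R := LinearMap.ext₂ fun Y Z => by
    simp [LinearMap.sum_apply, Finset.mul_sum]

lemma ric_apply (R : Vec n →ₗ[ℝ] Vec n →ₗ[ℝ] Vec n →ₗ[ℝ] Vec n) (Y Z : Vec n) :
    ric R Y Z = ∑ i, inner ℝ (sb i) (R (sb i) Y Z) := by
  simp [ric, LinearMap.sum_apply]

/-- The trace of a bilinear form. -/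
def formTrace : (Vec n →ₗ[ℝ] Vec n →ₗ[ℝ] ℝ) →ₗ[ℝ] ℝ where
  toFun b := ∑ i, b (sb i) (sb i)
  map_add' _ _ := by simp [Finset.sum_add_distrib]
  map_smul' _ _ := by simp [Finset.mul_sum]

lemma formTrace_apply (b : Vec n →ₗ[ℝ] Vec n →ₗ[ℝ] ℝ) : formTrace b = ∑ i, b (sb i) (sb i) := rfl

/-- The endomorphism that represents a bilinear form. -/
def formToEnd : (Vec n →ₗ[ℝ] Vec n →ₗ[ℝ] ℝ) →ₗ[ℝ] (Vec n →ₗ[ℝ] Vec n) where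
  toFun b := ∑ j, (b.flip (sb j)).smulRight (sb j)
  map_add' b c := LinearMap.ext fun Y => by
    simp [LinearMap.sum_apply, add_smul, Finset.sum_add_distrib]
  map_smul' r b := LinearMap.ext fun Y => by
    simp [LinearMap.sum_apply, mul_smul, Finset.smul_sum]

lemma inner_sum_sb (Z : Vec n) (f : Vec n →ₗ[ℝ] ℝ) : ∑ j, f (sb j) * inner ℝ (sb j) Z = f Z := by
  conv_rhs => rw [← sb_expand Z]
  simp [real_inner_comm, mul_comm]

lemma inner_formToEnd (b : Vec n →ₗ[ℝ] Vec n →ₗ[ℝ] ℝ) (Y Z : Vec n) :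
    inner ℝ (formToEnd b Y) Z = b Y Z := by
  simp only [formToEnd, LinearMap.coe_mk, AddHom.coe_mk, LinearMap.sum_apply,
    LinearMap.smulRight_apply, LinearMap.flip_apply, sum_inner, real_inner_smul_left]
  exact inner_sum_sb Z (b Y)

/-- A multiple of the trace-free symmetric part of the Ricci contraction. -/
def tfRic : (Vec n →ₗ[ℝ] Vec n →ₗ[ℝ] Vec n →ₗ[ℝ] Vec n) →ₗ[ℝ] (Vec n →ₗ[ℝ] Vec n) :=
  (n : ℝ) • (formToEnd ∘ₗ ric + formToEnd ∘ₗ swapArgs ℝ ∘ₗ ric)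
    - (2 : ℝ) • (formTrace ∘ₗ ric).smulRight LinearMap.id

lemma inner_tfRic (R : Vec n →ₗ[ℝ] Vec n →ₗ[ℝ] Vec n →ₗ[ℝ] Vec n) (Y Z : Vec n) :
    inner ℝ (tfRic R Y) Z =
      n * (ric R Y Z + ric R Z Y) - 2 * formTrace (ric R) * inner ℝ Y Z := by
  simp only [tfRic, LinearMap.sub_apply, LinearMap.smul_apply, LinearMap.add_apply,
    LinearMap.comp_apply, LinearMap.smulRight_apply, LinearMap.id_apply, inner_sub_left,
    inner_add_left, real_inner_smul_left, inner_formToEnd]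
  change _ * (_ + ric R Z Y) - _ = _
  ring

lemma trace_eq_sum_sb (A : Vec n →ₗ[ℝ] Vec n) :
    LinearMap.trace ℝ (Vec n) A = ∑ i, inner ℝ (A (sb i)) (sb i) := by
  rw [LinearMap.trace_eq_sum_inner A (EuclideanSpace.basisFun (Fin n) ℝ)]
  refine Finset.sum_congr rfl fun i _ => ?_
  rw [real_inner_comm]
  simp [sb]

lemma sum_inner_sb : ∑ i : Fin n, inner ℝ (sb i : Vec n) (sb i) = (n : ℝ) := by
  simp [sb]

variable (G : Subgroup (Vec n ≃ₗᵢ[ℝ] Vec n))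

/-- The factors `n` and `2` make the trace `n · 2 tr Ric - 2 tr Ric · n`, without a division by `n`.
-/
lemma tfRic_mem (R : Vec n →ₗ[ℝ] Vec n →ₗ[ℝ] Vec n →ₗ[ℝ] Vec n) :
    tfRic R ∈ (traceFreeSym G).toSubmodule := by
  refine ⟨fun v w => ?_, ?_⟩
  · rw [real_inner_comm (tfRic R w) v, inner_tfRic, inner_tfRic, real_inner_comm]
    ring
  · rw [trace_eq_sum_sb]
    simp only [inner_tfRic, Finset.sum_sub_distrib, ← Finset.mul_sum, sum_inner_sb,
      Finset.sum_add_distrib]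
    rw [formTrace_apply]
    ring

/-- The contraction may be computed in the orthonormal basis `h⁻¹ eᵢ` instead of `eᵢ`. -/
lemma ric_curvRep (h : G) (R : Vec n →ₗ[ℝ] Vec n →ₗ[ℝ] Vec n →ₗ[ℝ] Vec n) (Y Z : Vec n) :
    ric (curvRep G h R) Y Z = ric R (stdRep G h⁻¹ Y) (stdRep G h⁻¹ Z) := by
  rw [ric_apply, ric_apply]
  have := (isInvariantInner_std G).sum_apply isOrthonormalBasis_sb
    ((innerₗ (Vec n)).compl₂ (LinearMap.applyₗ (stdRep G h⁻¹ Z) ∘ₗ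
      LinearMap.applyₗ (stdRep G h⁻¹ Y) ∘ₗ R)) h⁻¹
  refine Eq.trans (Finset.sum_congr rfl fun i _ => ?_) this
  rw [curvRep_apply]
  have h1 := stdRep_inner_left G h⁻¹ (sb i) (R (stdRep G h⁻¹ (sb i)) (stdRep G h⁻¹ Y)
    (stdRep G h⁻¹ Z))
  rw [inv_inv] at h1
  exact h1.symm

lemma tfRic_curvRep (h : G) (R : Vec n →ₗ[ℝ] Vec n →ₗ[ℝ] Vec n →ₗ[ℝ] Vec n) :
    tfRic (curvRep G h R) = endRep G h (tfRic R) := by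
  refine LinearMap.ext fun Y => ext_inner_right ℝ fun Z => ?_
  rw [endRep_apply, stdRep_inner_left, inner_tfRic, inner_tfRic, ric_curvRep, ric_curvRep,
    stdRep_inner]
  congr 3
  rw [formTrace_apply, formTrace_apply]
  simp only [ric_curvRep]
  exact (isInvariantInner_std G).sum_apply isOrthonormalBasis_sb (ric R) h⁻¹

lemma bianchi_curvRep (h : G) (R : Vec n →ₗ[ℝ] Vec n →ₗ[ℝ] Vec n →ₗ[ℝ] Vec n) :
    bianchi (curvRep G h R) = curvRep G h (bianchi R) := by
  refine LinearMap.ext fun X => LinearMap.ext₂ fun Y Z => ?_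
  simp only [bianchi_apply, curvRep_apply, map_add]

/-- `Λ²V ⊗ 𝔤`. -/
def formsInLieAlg : Subrepresentation (curvRep G) where
  toSubmodule :=
    { carrier := {R | (∀ X Y, R X Y = -R Y X) ∧ ∀ X Y, R X Y ∈ lieAlg G}
      zero_mem' := by simp
      add_mem' := by
        rintro R S ⟨h1, h2⟩ ⟨k1, k2⟩
        refine ⟨fun X Y => ?_, fun X Y => (lieAlg G).add_mem (h2 X Y) (k2 X Y)⟩
        simp only [LinearMap.add_apply]; rw [h1, k1]; abel
      smul_mem' := by
        rintro c R ⟨h1, h2⟩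
        refine ⟨fun X Y => ?_, fun X Y => (lieAlg G).smul_mem c (h2 X Y)⟩
        simp only [LinearMap.smul_apply]; rw [h1, smul_neg] }
  apply_mem_toSubmodule := by
    rintro h R ⟨h1, h2⟩
    refine ⟨fun X Y => ?_, fun X Y => endRep_mem_lieAlg G h (h2 _ _)⟩
    ext1 Z
    rw [LinearMap.neg_apply, curvRep_apply, curvRep_apply, h1, LinearMap.neg_apply, map_neg]

/-- `(X₀, ξ) ↦ X₀ ∧ ξ`. -/
def wedge : Vec n →ₗ[ℝ] (Vec n →ₗ[ℝ] Vec n →ₗ[ℝ] Vec n) →ₗ[ℝ]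
    (Vec n →ₗ[ℝ] Vec n →ₗ[ℝ] Vec n →ₗ[ℝ] Vec n) :=
  LinearMap.mk₂ ℝ (fun X₀ ξ => (innerₗ (Vec n) X₀).smulRight ξ -
      ((innerₗ (Vec n) X₀).smulRight ξ).flip)
    (fun X X' ξ => by
      refine LinearMap.ext fun U => LinearMap.ext₂ fun Y Z => ?_
      simp [add_smul]; abel)
    (fun c X ξ => by
      refine LinearMap.ext fun U => LinearMap.ext₂ fun Y Z => ?_
      simp [mul_smul, smul_sub])
    (fun X ξ ξ' => by
      refine LinearMap.ext fun U => LinearMap.ext₂ fun Y Z => ?_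
      simp; abel)
    (fun c X ξ => by
      refine LinearMap.ext fun U => LinearMap.ext₂ fun Y Z => ?_
      simp [smul_sub, smul_comm c])

lemma wedge_apply (X₀ : Vec n) (ξ : Vec n →ₗ[ℝ] Vec n →ₗ[ℝ] Vec n) (X Y Z : Vec n) :
    wedge X₀ ξ X Y Z = inner ℝ X₀ X • ξ Y Z - inner ℝ X₀ Y • ξ X Z := rfl

lemma wedge_equivariant (h : G) (X₀ : Vec n) (ξ : Vec n →ₗ[ℝ] Vec n →ₗ[ℝ] Vec n) :
    wedge (stdRep G h X₀) (tensorRep G h ξ) = curvRep G h (wedge X₀ ξ) := by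
  refine LinearMap.ext fun X => LinearMap.ext₂ fun Y Z => ?_
  simp only [wedge_apply, curvRep_apply, map_sub, map_smul, stdRep_inner_left]
  rfl

/-- The quadratic part of the curvature, polarized. -/
def quadCurv : (Vec n →ₗ[ℝ] Vec n →ₗ[ℝ] Vec n) →ₗ[ℝ] (Vec n →ₗ[ℝ] Vec n →ₗ[ℝ] Vec n) →ₗ[ℝ]
    (Vec n →ₗ[ℝ] Vec n →ₗ[ℝ] Vec n →ₗ[ℝ] Vec n) :=
  LinearMap.mk₂ ℝ (fun ξ η =>
      (((LinearMap.mul ℝ (Module.End ℝ (Vec n))).compl₁₂ ξ η : Vec n →ₗ[ℝ] Vec n →ₗ[ℝ] _) -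
        ((LinearMap.mul ℝ (Module.End ℝ (Vec n))).compl₁₂ ξ η : Vec n →ₗ[ℝ] Vec n →ₗ[ℝ] _).flip) -
      (η.compr₂ ξ - (η.compr₂ ξ).flip))
    (fun ξ ξ' η => by
      refine LinearMap.ext fun X => LinearMap.ext₂ fun Y Z => ?_
      simp; abel)
    (fun c ξ η => by
      refine LinearMap.ext fun X => LinearMap.ext₂ fun Y Z => ?_
      simp [smul_sub])
    (fun ξ η η' => by
      refine LinearMap.ext fun X => LinearMap.ext₂ fun Y Z => ?_
      simp; abel)
    (fun c ξ η => by
      refine LinearMap.ext fun X => LinearMap.ext₂ fun Y Z => ?_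
      simp [smul_sub])

lemma quadCurv_apply (ξ η : Vec n →ₗ[ℝ] Vec n →ₗ[ℝ] Vec n) (X Y Z : Vec n) :
    quadCurv ξ η X Y Z = ξ X (η Y Z) - ξ Y (η X Z) - (ξ (η X Y) Z - ξ (η Y X) Z) := rfl

lemma tensorRep_apply₂ (h : G) (ξ : Vec n →ₗ[ℝ] Vec n →ₗ[ℝ] Vec n) (X Y : Vec n) :
    tensorRep G h ξ X Y = stdRep G h (ξ (stdRep G h⁻¹ X) (stdRep G h⁻¹ Y)) := rfl

lemma quadCurv_equivariant (h : G) (ξ η : Vec n →ₗ[ℝ] Vec n →ₗ[ℝ] Vec n) :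
    quadCurv (tensorRep G h ξ) (tensorRep G h η) = curvRep G h (quadCurv ξ η) := by
  refine LinearMap.ext fun X => LinearMap.ext₂ fun Y Z => ?_
  simp only [quadCurv_apply, curvRep_apply, map_sub, tensorRep_apply₂, stdRep_inv_self]

end AlgebraicCurvature

/-! ### The algebraic core: hypotheses (a), (b), (c) kill the trace-free Ricci contraction. -/

section Vanishing

variable {n : ℕ} {G : Subgroup (Vec n ≃ₗᵢ[ℝ] Vec n)}

/-- The trace-free symmetric Ricci contraction, as a map into `S²₀V`. -/
def tfRic₀ (G : Subgroup (Vec n ≃ₗᵢ[ℝ] Vec n)) :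
    (Vec n →ₗ[ℝ] Vec n →ₗ[ℝ] Vec n →ₗ[ℝ] Vec n) →ₗ[ℝ] (traceFreeSym G).toSubmodule :=
  LinearMap.codRestrict _ tfRic (tfRic_mem G)

lemma tfRic₀_curvRep (h : G) (R : Vec n →ₗ[ℝ] Vec n →ₗ[ℝ] Vec n →ₗ[ℝ] Vec n) :
    tfRic₀ G (curvRep G h R) = (traceFreeSym G).toRepresentation h (tfRic₀ G R) :=
  Subtype.ext (tfRic_curvRep G h R)

/-- This is Schur's argument applied to the restriction of the equivariant map `tfRic₀ G` to `𝒦(𝔤)`.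
-/
lemma tfRic₀_algCurv (hc : NoInvariants G ((algCurv G).toRepresentation.tprod
      (traceFreeSym G).toRepresentation))
    {R : Vec n →ₗ[ℝ] Vec n →ₗ[ℝ] Vec n →ₗ[ℝ] Vec n} (hR : R ∈ (algCurv G).toSubmodule) :
    tfRic₀ G R = 0 := by
  have := finite_submodule (algCurv G).toSubmodule
  have h := hc.linearMap_eq_zero ((isInvariantInner_curv G).subrep (algCurv G))
    (tfRic₀ G ∘ₗ (algCurv G).toSubmodule.subtype) (fun h x => tfRic₀_curvRep h _)
  exact LinearMap.congr_fun h ⟨R, hR⟩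

/-- An equivariant map that computes the trace-free symmetric Ricci contraction of an algebraic
curvature tensor from the complement of its component in `Λ²V ⊗ 𝔤`. -/
lemma exists_ricci_factorization (hc : NoInvariants G ((algCurv G).toRepresentation.tprod
      (traceFreeSym G).toRepresentation)) :
    ∃ Φ : (Vec n →ₗ[ℝ] Vec n →ₗ[ℝ] Vec n →ₗ[ℝ] Vec n) →ₗ[ℝ] (traceFreeSym G).toSubmodule,
      (∀ h R, Φ (curvRep G h R) = (traceFreeSym G).toRepresentation h (Φ R)) ∧
      ∀ T S, S ∈ (formsInLieAlg G).toSubmodule → bianchi (T + S) = 0 →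
        tfRic₀ G (T + S) = Φ T := by
  refine exists_equivariant_factorization (isInvariantInner_curv G) bianchi (bianchi_curvRep G)
    (tfRic₀ G) tfRic₀_curvRep (formsInLieAlg G) ?_
  intro R hR hb
  refine tfRic₀_algCurv hc ?_
  refine ⟨hR.1, hR.2, fun X Y Z => ?_⟩
  rw [← bianchi_apply, hb]
  rfl

/-- The trace-free Ricci contraction vanishes for a curvature tensor of the form that the
curvature of a `G`-structure has. -/
theorem tfRic_eq_zero {W : Subrepresentation (tensorRep G)}
    (ha : NoInvariants G (((stdRep G).tprod W.toRepresentation).tprod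
      (traceFreeSym G).toRepresentation))
    (hb : NoInvariants G ((symSquare G W.toRepresentation).toRepresentation.tprod
      (traceFreeSym G).toRepresentation))
    (hc : NoInvariants G ((algCurv G).toRepresentation.tprod
      (traceFreeSym G).toRepresentation))
    {R S : Vec n →ₗ[ℝ] Vec n →ₗ[ℝ] Vec n →ₗ[ℝ] Vec n} {ξ : Vec n →ₗ[ℝ] Vec n →ₗ[ℝ] Vec n}
    {D : Vec n →ₗ[ℝ] Vec n →ₗ[ℝ] Vec n →ₗ[ℝ] Vec n} (hξ : ξ ∈ W.toSubmodule)
    (hD : ∀ X, D X ∈ W.toSubmodule) (hS : S ∈ (formsInLieAlg G).toSubmodule)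
    (hbi : bianchi R = 0)
    (hR : ∀ X Y Z, R X Y Z = D X Y Z - D Y X Z + quadCurv ξ ξ X Y Z + S X Y Z) :
    tfRic R = 0 := by
  obtain ⟨Φ, hΦ, hfac⟩ := exists_ricci_factorization hc
  have := finite_submodule W.toSubmodule
  have hW := (isInvariantInner_tensor G).subrep W
  have h1 : ∀ (X : Vec n) (w : W.toSubmodule), Φ (wedge X w) = 0 :=
    ha.bilinear_eq_zero (isInvariantInner_std G) hW
      ((wedge.compl₂ W.toSubmodule.subtype).compr₂ Φ) (fun h X w => by
        refine Eq.trans ?_ (hΦ h _)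
        exact congrArg Φ (wedge_equivariant G h X w))
  have h2 : ∀ w : W.toSubmodule, Φ (quadCurv w w) = 0 :=
    hb.quadratic_eq_zero hW
      ((quadCurv.compl₁₂ W.toSubmodule.subtype W.toSubmodule.subtype).compr₂ Φ) (fun h v w => by
        refine Eq.trans ?_ (hΦ h _)
        exact congrArg Φ (quadCurv_equivariant G h v w))
  -- The antisymmetrized derivative `D X Y - D Y X` is written as `∑ eᵢ ∧ D eᵢ`, which exhibits it
  -- as the image of an element of `V ⊗ W`.
  let T := (∑ i, wedge (sb i) (D (sb i))) + quadCurv ξ ξ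
  have hT : R = T + S := by
    refine LinearMap.ext fun X => LinearMap.ext₂ fun Y Z => ?_
    have hs : ∀ X Y : Vec n, ∑ i, inner ℝ (sb i) X • D (sb i) Y Z = D X Y Z := fun X Y => by
      conv_rhs => rw [← sb_expand X]
      simp [real_inner_comm]
    simp only [T, hR, LinearMap.add_apply, LinearMap.sum_apply, wedge_apply,
      Finset.sum_sub_distrib, hs]
  have h3 : tfRic₀ G R = 0 := by
    rw [hT, hfac T S hS (by rw [← hT, hbi])]
    simp only [T, map_add, map_sum]
    rw [h2 ⟨ξ, hξ⟩, add_zero]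
    exact Finset.sum_eq_zero fun i _ => h1 (sb i) ⟨_, hD _⟩
  exact congrArg Subtype.val h3

end Vanishing

/-! ### Pair symmetry, symmetry of Ricci, and the contracted second Bianchi identity. -/

section CurvatureSymmetries

variable {n : ℕ} {R : Vec n →ₗ[ℝ] Vec n →ₗ[ℝ] Vec n →ₗ[ℝ] Vec n}

/-- The classical combination of the four cyclic Bianchi sums of `X, Y, Z, U`, reduced by the two
skew-symmetries. -/
lemma pair_symmetry (h1 : ∀ X Y Z, R X Y Z = - R Y X Z)
    (h2 : ∀ X Y Z U, inner ℝ (R X Y Z) U = - inner ℝ Z (R X Y U)) (h3 : bianchi R = 0)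
    (X Y Z U : Vec n) : inner ℝ (R X Y Z) U = inner ℝ (R Z U X) Y := by
  let r : Vec n → Vec n → Vec n → Vec n → ℝ := fun X Y Z U => inner ℝ (R X Y Z) U
  have k1 : ∀ X Y Z U, r X Y Z U = - r Y X Z U := fun X Y Z U => by
    simp only [r]; rw [h1, inner_neg_left]
  have k2 : ∀ X Y Z U, r X Y Z U = - r X Y U Z := fun X Y Z U => by
    simp only [r]; rw [h2, real_inner_comm]
  have k3 : ∀ X Y Z U, r X Y Z U + r Y Z X U + r Z X Y U = 0 := fun X Y Z U => by
    simp only [r]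
    rw [← inner_add_left, ← inner_add_left, ← bianchi_apply, h3]
    simp
  change r X Y Z U = r Z U X Y
  linarith [k3 X Y Z U, k3 Y Z U X, k3 Z U X Y, k3 U X Y Z, k1 X Y Z U, k1 Y Z X U, k1 Z X Y U,
    k2 X Y Z U, k2 Y Z U X, k2 Z U X Y, k2 U X Y Z, k1 Y Z U X, k1 Z U Y X, k1 U Y Z X, k1 Z U X Y,
    k1 U X Z Y, k1 X Z U Y, k1 U X Y Z, k1 X Y U Z, k1 Y U X Z, k2 Z X Y U, k2 X Z Y U, k2 Y U X Z,
    k2 U Y X Z, k2 Y Z X U, k2 U X Z Y]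

lemma ric_symm (h1 : ∀ X Y Z, R X Y Z = - R Y X Z)
    (h2 : ∀ X Y Z U, inner ℝ (R X Y Z) U = - inner ℝ Z (R X Y U)) (h3 : bianchi R = 0)
    (Y Z : Vec n) : ric R Y Z = ric R Z Y := by
  rw [ric_apply, ric_apply]
  refine Finset.sum_congr rfl fun i _ => ?_
  rw [real_inner_comm, pair_symmetry h1 h2 h3, h1, inner_neg_left, h2, neg_neg, real_inner_comm,
    real_inner_comm]

/-- If the Ricci contraction of `R` has no trace-free part, it is a multiple of the inner
product. -/
lemma ric_eq_of_tfRic_eq_zero (h1 : ∀ X Y Z, R X Y Z = - R Y X Z)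
    (h2 : ∀ X Y Z U, inner ℝ (R X Y Z) U = - inner ℝ Z (R X Y U)) (h3 : bianchi R = 0)
    (h : tfRic R = 0) (Y Z : Vec n) :
    ric R Y Z = formTrace (ric R) / n * inner ℝ Y Z := by
  rcases Nat.eq_zero_or_pos n with rfl | hn
  · rw [Subsingleton.elim Y 0]; simp
  · have := inner_tfRic R Y Z
    rw [h, ric_symm h1 h2 h3 Z Y] at this
    have hn' : (n : ℝ) ≠ 0 := by positivity
    simp only [LinearMap.zero_apply, inner_zero_left] at this
    field_simp
    linarith

/-- The contracted second Bianchi identity for an Einstein curvature tensor. -/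
lemma eq_zero_of_contracted_bianchi {D : Vec n → Vec n →ₗ[ℝ] Vec n →ₗ[ℝ] Vec n →ₗ[ℝ] Vec n}
    {l : Vec n →ₗ[ℝ] ℝ}
    (h1 : ∀ U X Y Z, D U X Y Z = - D U Y X Z)
    (h2 : ∀ U X Y Z T, inner ℝ (D U X Y Z) T = - inner ℝ Z (D U X Y T))
    (h3 : ∀ U X Y Z, D U X Y Z + D X Y U Z + D Y U X Z = 0)
    (hl : ∀ U Y Z, ric (D U) Y Z = l U * inner ℝ Y Z) (hn : n ≠ 2) (U : Vec n) : l U = 0 := by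
  have hU : ∑ i, l (sb i) * inner ℝ U (sb i) = l U := by
    simp_rw [real_inner_comm _ U]
    exact inner_sum_sb U l
  -- Contract the cyclic sum over `U, eᵢ, eⱼ`, applied to `eⱼ`, with `eᵢ`. The first term gives `n
  -- l(U)` and each of the other two gives `-l(U)`, hence the factor `n - 2`.
  have e1 : ∑ j, ∑ i, inner ℝ (sb i) (D U (sb i) (sb j) (sb j)) = n * l U := by
    simp_rw [← ric_apply, hl, ← Finset.mul_sum, sum_inner_sb, mul_comm]
  have e2 : ∑ i, ∑ j, inner ℝ (sb i) (D (sb i) (sb j) U (sb j)) = - l U := by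
    rw [← hU, ← Finset.sum_neg_distrib]
    refine Finset.sum_congr rfl fun i _ => ?_
    rw [← hl, ric_apply, ← Finset.sum_neg_distrib]
    refine Finset.sum_congr rfl fun j _ => ?_
    rw [real_inner_comm, h2]
  have e3 : ∑ j, ∑ i, inner ℝ (sb i) (D (sb j) U (sb i) (sb j)) = - l U := by
    rw [← hU, ← Finset.sum_neg_distrib]
    refine Finset.sum_congr rfl fun i _ => ?_
    rw [← hl, ric_apply, ← Finset.sum_neg_distrib]
    refine Finset.sum_congr rfl fun j _ => ?_
    rw [h1, inner_neg_right]
  have h0 : ∑ j, ∑ i, (inner ℝ (sb i) (D U (sb i) (sb j) (sb j)) +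
      inner ℝ (sb i) (D (sb i) (sb j) U (sb j)) +
      inner ℝ (sb i) (D (sb j) U (sb i) (sb j))) = 0 :=
    Finset.sum_eq_zero fun j _ => Finset.sum_eq_zero fun i _ => by
      rw [← inner_add_right, ← inner_add_right, h3, inner_zero_right]
  simp only [Finset.sum_add_distrib] at h0
  rw [Finset.sum_comm (f := fun j i => inner ℝ (sb i) (D (sb i) (sb j) U (sb j))), e1, e2, e3] at h0
  have h4 : ((n : ℝ) - 2) * l U = 0 := by linarith
  rcases mul_eq_zero.mp h4 with h | h
  · exact absurd (by exact_mod_cast sub_eq_zero.mp h) hn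
  · exact h

end CurvatureSymmetries

/-! ### Connection forms with values in an algebra: gauge change and the second Bianchi identity. -/

section ConnectionForms

open Topology Filter

variable {V : Type*} [NormedAddCommGroup V] [NormedSpace ℝ V]
  {A : Type*} [NormedRing A] [NormedAlgebra ℝ A]

/-- `(a, b) ↦ w(a) w'(b)`. -/
def mulForm (w w' : V →L[ℝ] A) : V →L[ℝ] V →L[ℝ] A :=
  (((ContinuousLinearMap.compL ℝ V A A).flip w').comp (ContinuousLinearMap.mul ℝ A)).comp w

/-- The curvature `dw + w ∧ w` of the connection form `w`. -/
def curvForm (w : V → V →L[ℝ] A) (u : V) : V →L[ℝ] V →L[ℝ] A :=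
  fderiv ℝ w u - (fderiv ℝ w u).flip + (mulForm (w u) (w u) - (mulForm (w u) (w u)).flip)

lemma curvForm_apply (w : V → V →L[ℝ] A) (u a b : V) :
    curvForm w u a b = fderiv ℝ w u a b - fderiv ℝ w u b a + (w u a * w u b - w u b * w u a) := rfl

lemma curvForm_swap (w : V → V →L[ℝ] A) (u a b : V) : curvForm w u a b = - curvForm w u b a := by
  rw [curvForm_apply, curvForm_apply]; abel

lemma ContDiffAt.mulForm {w w' : V → V →L[ℝ] A} {u : V} (hw : ContDiffAt ℝ ∞ w u)
    (hw' : ContDiffAt ℝ ∞ w' u) : ContDiffAt ℝ ∞ (fun v => mulForm (w v) (w' v)) u :=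
  (((ContinuousLinearMap.contDiff _).contDiffAt.comp u hw').clm_comp contDiffAt_const).clm_comp hw

lemma ContDiffAt.clm_flip {E F G D : Type*} [NormedAddCommGroup E] [NormedSpace ℝ E]
    [NormedAddCommGroup F] [NormedSpace ℝ F] [NormedAddCommGroup G] [NormedSpace ℝ G]
    [NormedAddCommGroup D] [NormedSpace ℝ D] {f : D → E →L[ℝ] F →L[ℝ] G} {u : D}
    (hf : ContDiffAt ℝ ∞ f u) : ContDiffAt ℝ ∞ (fun v => (f v).flip) u := by
  let L : (E →L[ℝ] F →L[ℝ] G) →L[ℝ] (F →L[ℝ] E →L[ℝ] G) :=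
    ((ContinuousLinearMap.flipₗᵢ ℝ E F G).toContinuousLinearEquiv :
      (E →L[ℝ] F →L[ℝ] G) →L[ℝ] (F →L[ℝ] E →L[ℝ] G))
  exact (ContinuousLinearMap.contDiff (F := F →L[ℝ] E →L[ℝ] G) L).contDiffAt.comp u hf

lemma ContDiffAt.fderiv_infty {E F : Type*} [NormedAddCommGroup E] [NormedSpace ℝ E]
    [NormedAddCommGroup F] [NormedSpace ℝ F] {f : E → F} {u : E}
    (hf : ContDiffAt ℝ ∞ f u) : ContDiffAt ℝ ∞ (fderiv ℝ f) u :=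
  hf.fderiv_right (by simp)

lemma ContDiffAt.curvForm {w : V → V →L[ℝ] A} {u : V} (hw : ContDiffAt ℝ ∞ w u) :
    ContDiffAt ℝ ∞ (curvForm w) u := by
  have h1 := ContDiffAt.fderiv_infty hw
  have h2 := ContDiffAt.mulForm hw hw
  exact (h1.sub (ContDiffAt.clm_flip h1)).add (h2.sub (ContDiffAt.clm_flip h2))

lemma fderiv_fderiv_symm {E F : Type*} [NormedAddCommGroup E] [NormedSpace ℝ E]
    [NormedAddCommGroup F] [NormedSpace ℝ F] {f : E → F} {u : E}
    (hf : ContDiffAt ℝ ∞ f u) (a b : E) :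
    fderiv ℝ (fderiv ℝ f) u a b = fderiv ℝ (fderiv ℝ f) u b a :=
  (hf.isSymmSndFDerivAt (by
    rw [minSmoothness_of_isRCLikeNormedField]; exact WithTop.coe_le_coe.mpr le_top)).eq a b

/-- The curvature transforms by conjugation under a change of frame. -/
lemma mul_curvForm_of_gauge {e : V → A} {w Γ : V → V →L[ℝ] A} {u : V}
    (he : ContDiffAt ℝ ∞ e u) (hw : ContDiffAt ℝ ∞ w u) (hΓ : ContDiffAt ℝ ∞ Γ u)
    (h : ∀ᶠ v in 𝓝 u, ∀ a, e v * w v a = fderiv ℝ e v a + Γ v a * e v) (a b : V) :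
    e u * curvForm w u a b = curvForm Γ u a b * e u := by
  have de := (he.differentiableAt (by simp)).hasFDerivAt
  have dde := ((ContDiffAt.fderiv_infty he).differentiableAt (by simp)).hasFDerivAt
  have dw := (hw.differentiableAt (by simp)).hasFDerivAt
  have dΓ := (hΓ.differentiableAt (by simp)).hasFDerivAt
  -- The gauge relation `e w = de + Γ e`, differentiated in the direction `b`. Antisymmetrizing in
  -- `a, b` removes the second derivative of `e`, and `ea` then eliminates the first derivatives.
  have key : ∀ a b, e u * fderiv ℝ w u b a + fderiv ℝ e u b * w u a =
      fderiv ℝ (fderiv ℝ e) u b a + (Γ u a * fderiv ℝ e u b + fderiv ℝ Γ u b a * e u) := by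
    intro a b
    have h1 := de.mul' (dw.clm_apply (hasFDerivAt_const a u))
    have h2 := (dde.clm_apply (hasFDerivAt_const a u)).add
      ((dΓ.clm_apply (hasFDerivAt_const a u)).mul' de)
    have h3 := h1.unique (h2.congr_of_eventuallyEq (h.mono fun v hv => hv a))
    simpa using DFunLike.congr_fun h3 b
  have h0 := h.self_of_nhds
  have ea : ∀ a, fderiv ℝ e u a = e u * w u a - Γ u a * e u := fun a => by rw [h0]; abel
  have k1 := key a b
  have k2 := key b a
  rw [fderiv_fderiv_symm he a b, ea] at k2
  rw [ea] at k1
  rw [curvForm_apply, curvForm_apply]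
  have e1 : e u * fderiv ℝ w u b a = fderiv ℝ (fderiv ℝ e) u b a +
    (Γ u a * (e u * w u b - Γ u b * e u) + fderiv ℝ Γ u b a * e u)
      - (e u * w u b - Γ u b * e u) * w u a := by rw [← k1]; abel
  have e2 : e u * fderiv ℝ w u a b = fderiv ℝ (fderiv ℝ e) u b a +
    (Γ u b * (e u * w u a - Γ u a * e u) + fderiv ℝ Γ u a b * e u)
      - (e u * w u a - Γ u a * e u) * w u b := by rw [← k2]; abel
  rw [mul_add, mul_sub, e1, e2]
  noncomm_ring

/-- The second Bianchi identity. -/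
lemma second_bianchi {w : V → V →L[ℝ] A} {u : V} (hw : ContDiffAt ℝ ∞ w u) (a b c : V) :
    (fderiv ℝ (curvForm w) u a b c + (w u a * curvForm w u b c - curvForm w u b c * w u a)) +
    (fderiv ℝ (curvForm w) u b c a + (w u b * curvForm w u c a - curvForm w u c a * w u b)) +
    (fderiv ℝ (curvForm w) u c a b + (w u c * curvForm w u a b - curvForm w u a b * w u c))
      = 0 := by
  have dw := (hw.differentiableAt (by simp)).hasFDerivAt
  have ddw := ((ContDiffAt.fderiv_infty hw).differentiableAt (by simp)).hasFDerivAt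
  have dΩ := ((ContDiffAt.curvForm hw).differentiableAt (by simp)).hasFDerivAt
  have key : ∀ a b c, fderiv ℝ (curvForm w) u a b c =
      fderiv ℝ (fderiv ℝ w) u a b c - fderiv ℝ (fderiv ℝ w) u a c b +
      ((w u b * fderiv ℝ w u a c + fderiv ℝ w u a b * w u c) -
        (w u c * fderiv ℝ w u a b + fderiv ℝ w u a c * w u b)) := by
    intro a b c
    have h1 := (dΩ.clm_apply (hasFDerivAt_const b u)).clm_apply (hasFDerivAt_const c u)
    have hx : ∀ x, HasFDerivAt (fun v => w v x) _ u :=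
      fun x => dw.clm_apply (hasFDerivAt_const x u)
    have hxy : ∀ x y, HasFDerivAt (fun v => fderiv ℝ w v x y) _ u :=
      fun x y => (ddw.clm_apply (hasFDerivAt_const x u)).clm_apply (hasFDerivAt_const y u)
    have h2 := ((hxy b c).sub (hxy c b)).add
      (((hx b).mul' (hx c)).sub ((hx c).mul' (hx b)))
    have h3 := h1.unique h2
    simpa using DFunLike.congr_fun h3 a
  have s := fun x y z => DFunLike.congr_fun (fderiv_fderiv_symm hw x y) z
  rw [key, key, key, s b a, s c a, s c b]
  simp only [curvForm_apply]
  noncomm_ring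

end ConnectionForms

set_option maxSynthPendingDepth 3

/-! ### A torsion-free connection in a moving frame: structure equation, Bianchi identities,
invariance. -/

section Frames

open Topology Filter

variable {V : Type*} [NormedAddCommGroup V] [InnerProductSpace ℝ V]

/-- `θ` is, in the frame `e`, the connection form of the torsion-free connection with Christoffel
symbols `Γ`, in a neighbourhood of `u`. -/
structure IsFrameConnection (Γ : V → V →L[ℝ] V →L[ℝ] V) (e : V → V →L[ℝ] V)
    (θ : V → V →L[ℝ] V →L[ℝ] V) (u : V) : Prop where
  smooth_christoffel : ContDiffAt ℝ ∞ Γ u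
  symm : ∀ᶠ v in 𝓝 u, ∀ a b, Γ v a b = Γ v b a
  smooth_frame : ContDiffAt ℝ ∞ e u
  smooth_form : ContDiffAt ℝ ∞ θ u
  isUnit : ∀ᶠ v in 𝓝 u, IsUnit (e v)
  eq : ∀ᶠ v in 𝓝 u, ∀ X Y, e v (θ v X Y) = fderiv ℝ e v (e v X) Y + Γ v (e v X) (e v Y)

/-- The connection form as a form in the coordinates. -/
def coordForm (e : V → V →L[ℝ] V) (θ : V → V →L[ℝ] V →L[ℝ] V) (v : V) : V →L[ℝ] V →L[ℝ] V :=
  (θ v).comp (Ring.inverse (e v))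

/-- The curvature in the frame `e`. -/
def frameCurv (e : V → V →L[ℝ] V) (θ : V → V →L[ℝ] V →L[ℝ] V) (v : V) :
    V →L[ℝ] V →L[ℝ] V →L[ℝ] V :=
  (((ContinuousLinearMap.compL ℝ V V (V →L[ℝ] V)).flip (e v)).comp
    (curvForm (coordForm e θ) v)).comp (e v)

lemma frameCurv_apply (e : V → V →L[ℝ] V) (θ : V → V →L[ℝ] V →L[ℝ] V) (v X Y : V) :
    frameCurv e θ v X Y = curvForm (coordForm e θ) v (e v X) (e v Y) := rfl

lemma isUnit_clm {f : V →L[ℝ] V} (hf : IsUnit f) :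
    (∀ X, Ring.inverse f (f X) = X) ∧ ∀ X, f (Ring.inverse f X) = X :=
  ⟨fun X => DFunLike.congr_fun (Ring.inverse_mul_cancel f hf) X,
    fun X => DFunLike.congr_fun (Ring.mul_inverse_cancel f hf) X⟩

lemma injective_of_isUnit {f : V →L[ℝ] V} (hf : IsUnit f) {X Y : V} (h : f X = f Y) : X = Y := by
  rw [← (isUnit_clm hf).1 X, h, (isUnit_clm hf).1]

variable {Γ : V → V →L[ℝ] V →L[ℝ] V} {e : V → V →L[ℝ] V} {θ : V → V →L[ℝ] V →L[ℝ] V} {u : V}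

lemma coordForm_apply {v : V} (h : IsUnit (e v)) (X : V) : coordForm e θ v (e v X) = θ v X := by
  change θ v (Ring.inverse (e v) (e v X)) = _
  rw [(isUnit_clm h).1]

lemma IsFrameConnection.torsion (h : IsFrameConnection Γ e θ u) :
    ∀ᶠ v in 𝓝 u, ∀ X Y, e v (θ v X Y - θ v Y X) =
      fderiv ℝ e v (e v X) Y - fderiv ℝ e v (e v Y) X := by
  filter_upwards [h.symm, h.eq] with v h1 h2 X Y
  rw [map_sub, h2, h2, h1]
  abel

lemma IsFrameConnection.smooth_coordForm [CompleteSpace V] (h : IsFrameConnection Γ e θ u) :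
    ContDiffAt ℝ ∞ (coordForm e θ) u := by
  obtain ⟨x, hx⟩ := h.isUnit.self_of_nhds
  have h1 : ContDiffAt ℝ ∞ Ring.inverse (e u) := hx ▸ contDiffAt_ringInverse ℝ x
  exact h.smooth_form.clm_comp (h1.comp u h.smooth_frame)

lemma IsFrameConnection.smooth_frameCurv [CompleteSpace V] (h : IsFrameConnection Γ e θ u) :
    ContDiffAt ℝ ∞ (frameCurv e θ) u := by
  have h1 := ContDiffAt.curvForm h.smooth_coordForm
  have h2 : ContDiffAt ℝ ∞
      (fun v => (ContinuousLinearMap.compL ℝ V V (V →L[ℝ] V)).flip (e v)) u :=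
    (ContinuousLinearMap.contDiff _).contDiffAt.comp u h.smooth_frame
  exact (h2.clm_comp h1).clm_comp h.smooth_frame

/-- The equation for `θ` says that `coordForm e θ` is the gauge transform of `Γ` by `e`, so the two
curvatures are conjugate by `e`. -/
lemma IsFrameConnection.frame_frameCurv [CompleteSpace V] (h : IsFrameConnection Γ e θ u)
    (X Y Z : V) :
    e u (frameCurv e θ u X Y Z) = curvForm Γ u (e u X) (e u Y) (e u Z) := by
  have hg : ∀ᶠ v in 𝓝 u, ∀ a, e v * coordForm e θ v a = fderiv ℝ e v a + Γ v a * e v := by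
    filter_upwards [h.isUnit, h.eq] with v h1 h2 a
    refine ContinuousLinearMap.ext fun Y => ?_
    have h3 := h2 (Ring.inverse (e v) a) Y
    rw [(isUnit_clm h1).2] at h3
    exact h3
  exact DFunLike.congr_fun (mul_curvForm_of_gauge h.smooth_frame h.smooth_coordForm
    h.smooth_christoffel hg (e u X) (e u Y)) Z

/-- The structure equation in the frame. The last term is the value of the connection form on the
bracket of the fields `eX` and `eY`, which by vanishing torsion is `e (θ X Y - θ Y X)`. Only `θ` and
its derivatives along the frame remain. -/
lemma IsFrameConnection.frameCurv_eq [CompleteSpace V] (h : IsFrameConnection Γ e θ u)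
    (X Y : V) :
    frameCurv e θ u X Y = fderiv ℝ θ u (e u X) Y - fderiv ℝ θ u (e u Y) X +
      (θ u X * θ u Y - θ u Y * θ u X) - θ u (θ u X Y - θ u Y X) := by
  have hu := h.isUnit.self_of_nhds
  have dw := (h.smooth_coordForm.differentiableAt (by simp)).hasFDerivAt
  have dθ := (h.smooth_form.differentiableAt (by simp)).hasFDerivAt
  have de := (h.smooth_frame.differentiableAt (by simp)).hasFDerivAt
  have key : ∀ a Y, fderiv ℝ θ u a Y = fderiv ℝ (coordForm e θ) u a (e u Y) +
      coordForm e θ u (fderiv ℝ e u a Y) := by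
    intro a Y
    have h1 := dθ.clm_apply (hasFDerivAt_const Y u)
    have h2 := dw.clm_apply (de.clm_apply (hasFDerivAt_const Y u))
    have h3 := h1.unique (h2.congr_of_eventuallyEq (h.isUnit.mono fun v hv =>
      (coordForm_apply hv Y).symm))
    simpa [add_comm] using DFunLike.congr_fun h3 a
  have ht := h.torsion.self_of_nhds X Y
  rw [frameCurv_apply, curvForm_apply, coordForm_apply hu, coordForm_apply hu, key, key,
    ← coordForm_apply (θ := θ) hu (θ u X Y - θ u Y X), ht, map_sub]
  abel

/-- The symmetry of `Γ` passes to its derivative, after which all terms of the cyclic sum cancel in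
pairs. -/
lemma curvForm_bianchi {v : V} (hΓ : ContDiffAt ℝ ∞ Γ v)
    (hs : ∀ᶠ v in 𝓝 v, ∀ a b, Γ v a b = Γ v b a) (a b c : V) :
    curvForm Γ v a b c + curvForm Γ v b c a + curvForm Γ v c a b = 0 := by
  have dΓ := (hΓ.differentiableAt (by simp)).hasFDerivAt
  have key : ∀ a b c, fderiv ℝ Γ v a b c = fderiv ℝ Γ v a c b := by
    intro a b c
    have h1 := (dΓ.clm_apply (hasFDerivAt_const b v)).clm_apply (hasFDerivAt_const c v)
    have h2 := (dΓ.clm_apply (hasFDerivAt_const c v)).clm_apply (hasFDerivAt_const b v)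
    have h3 := h1.unique (h2.congr_of_eventuallyEq (hs.mono fun v hv => hv b c))
    simpa using DFunLike.congr_fun h3 a
  have h0 := hs.self_of_nhds
  simp only [curvForm_apply, add_apply, sub_apply,
    mul_apply_eq_comp]
  rw [key b a c, key a c b, key c b a, h0 a c, h0 b c, h0 a b]
  abel

lemma IsFrameConnection.bianchi [CompleteSpace V] (h : IsFrameConnection Γ e θ u)
    (X Y Z : V) :
    frameCurv e θ u X Y Z + frameCurv e θ u Y Z X + frameCurv e θ u Z X Y = 0 := by
  refine injective_of_isUnit h.isUnit.self_of_nhds ?_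
  rw [map_add, map_add, map_zero, h.frame_frameCurv, h.frame_frameCurv, h.frame_frameCurv]
  exact curvForm_bianchi h.smooth_christoffel h.symm _ _ _

/-- The covariant derivative of the curvature, in the frame `e`. -/
def frameCurvDeriv (e : V → V →L[ℝ] V) (θ : V → V →L[ℝ] V →L[ℝ] V) (u U : V) :
    V →L[ℝ] V →L[ℝ] V →L[ℝ] V :=
  fderiv ℝ (frameCurv e θ) u (e u U) +
    (((ContinuousLinearMap.compL ℝ V (V →L[ℝ] V) (V →L[ℝ] V))
      (ContinuousLinearMap.compL ℝ V V V (θ u U))).comp (frameCurv e θ u) -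
    ((ContinuousLinearMap.compL ℝ V (V →L[ℝ] V) (V →L[ℝ] V))
      ((ContinuousLinearMap.compL ℝ V V V).flip (θ u U))).comp (frameCurv e θ u)) -
    (frameCurv e θ u).comp (θ u U) - ((frameCurv e θ u).flip.comp (θ u U)).flip

lemma frameCurvDeriv_apply (u U X Y Z : V) :
    frameCurvDeriv e θ u U X Y Z = fderiv ℝ (frameCurv e θ) u (e u U) X Y Z +
      (θ u U (frameCurv e θ u X Y Z) - frameCurv e θ u X Y (θ u U Z)) -
      frameCurv e θ u (θ u U X) Y Z - frameCurv e θ u X (θ u U Y) Z := rfl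

/-- The Bianchi identity of the coordinate form is evaluated on the frame. Differentiating
`frameCurv` also differentiates the frame in its two arguments; with `de = eθ - Γ(e, e)` the `θ`
terms are those of the covariant derivative, and the `Γ` terms cancel in the cyclic sum by symmetry
of `Γ`. -/
lemma IsFrameConnection.second_bianchi [CompleteSpace V] (h : IsFrameConnection Γ e θ u)
    (U X Y Z : V) : frameCurvDeriv e θ u U X Y Z + frameCurvDeriv e θ u X Y U Z +
      frameCurvDeriv e θ u Y U X Z = 0 := by
  have hu := h.isUnit.self_of_nhds
  have hw := h.smooth_coordForm
  have dΩ := ((ContDiffAt.curvForm hw).differentiableAt (by simp)).hasFDerivAt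
  have dR := (h.smooth_frameCurv.differentiableAt (by simp)).hasFDerivAt
  have de := (h.smooth_frame.differentiableAt (by simp)).hasFDerivAt
  have key : ∀ a X Y, fderiv ℝ (frameCurv e θ) u a X Y =
      fderiv ℝ (curvForm (coordForm e θ)) u a (e u X) (e u Y) +
      curvForm (coordForm e θ) u (fderiv ℝ e u a X) (e u Y) +
      curvForm (coordForm e θ) u (e u X) (fderiv ℝ e u a Y) := by
    intro a X Y
    have h1 := (dR.clm_apply (hasFDerivAt_const X u)).clm_apply (hasFDerivAt_const Y u)
    have h2 := (dΩ.clm_apply (de.clm_apply (hasFDerivAt_const X u))).clm_apply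
      (de.clm_apply (hasFDerivAt_const Y u))
    have h3 := DFunLike.congr_fun (h1.unique h2) a
    simp at h3
    rw [h3]
    abel
  have hΓ := h.symm.self_of_nhds
  have he := h.eq.self_of_nhds
  have hde : ∀ X Y, fderiv ℝ e u (e u X) Y = e u (θ u X Y) - Γ u (e u X) (e u Y) := fun X Y => by
    rw [he]; abel
  have hb := DFunLike.congr_fun (GStructures.second_bianchi hw (e u U) (e u X) (e u Y)) Z
  simp only [coordForm_apply hu, add_apply, sub_apply,
    mul_apply_eq_comp, zero_apply, ← frameCurv_apply] at hb
  have sw : ∀ a b c, curvForm (coordForm e θ) u a b c = - curvForm (coordForm e θ) u b a c :=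
    fun a b c => by rw [curvForm_swap]; rfl
  simp only [frameCurvDeriv_apply, key, hde, map_sub, add_apply,
    sub_apply]
  simp only [frameCurv_apply] at hb ⊢
  rw [hΓ (e u X) (e u U), hΓ (e u Y) (e u U), hΓ (e u Y) (e u X),
    sw (e u Y) (Γ u (e u U) (e u X)), sw (e u U) (Γ u (e u X) (e u Y)),
    sw (e u X) (Γ u (e u U) (e u Y))]
  rw [← hb]
  abel

/-- Uniqueness of the Levi-Civita connection: the difference is symmetric in its first two arguments
and skew in its last two, hence zero. -/
lemma eq_of_skew_of_torsion {S T : V →L[ℝ] V →L[ℝ] V}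
    (hS : ∀ X Y Z, inner ℝ (S X Y) Z = - inner ℝ Y (S X Z))
    (hT : ∀ X Y Z, inner ℝ (T X Y) Z = - inner ℝ Y (T X Z))
    (h : ∀ X Y, S X Y - S Y X = T X Y - T Y X) : S = T := by
  let d : V → V → V → ℝ := fun X Y Z => inner ℝ (S X Y - T X Y) Z
  have d1 : ∀ X Y Z, d X Y Z = - d X Z Y := fun X Y Z => by
    simp only [d, inner_sub_left, hS X Y, hT X Y]
    rw [real_inner_comm Y, real_inner_comm Y]; ring
  have d2 : ∀ X Y Z, d X Y Z = d Y X Z := fun X Y Z => by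
    simp only [d]
    congr 1
    have := h X Y
    rw [sub_eq_sub_iff_sub_eq_sub]
    exact this
  have d0 : ∀ X Y Z, d X Y Z = 0 := fun X Y Z => by
    linarith [d1 X Y Z, d2 X Z Y, d1 Z X Y, d2 Z Y X, d1 Y Z X, d2 Y X Z]
  refine ContinuousLinearMap.ext fun X => ContinuousLinearMap.ext fun Y => ?_
  rw [← sub_eq_zero]
  exact inner_self_eq_zero.mp (d0 X Y _)

/-- The curvature in a frame does not depend on the coordinates. -/
lemma IsFrameConnection.frameCurv_change [CompleteSpace V] {Γ' : V → V →L[ℝ] V →L[ℝ] V}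
    {e' : V → V →L[ℝ] V} {θ' : V → V →L[ℝ] V →L[ℝ] V} {τ : V → V}
    (h : IsFrameConnection Γ e θ u) (h' : IsFrameConnection Γ' e' θ' (τ u))
    (hτ : ContDiffAt ℝ ∞ τ u) (he : ∀ᶠ v in 𝓝 u, ∀ Y, e' (τ v) Y = fderiv ℝ τ v (e v Y))
    (hθ : ∀ᶠ v in 𝓝 u, ∀ X Y Z, inner ℝ (θ v X Y) Z = - inner ℝ Y (θ v X Z))
    (hθ' : ∀ᶠ v in 𝓝 (τ u), ∀ X Y Z, inner ℝ (θ' v X Y) Z = - inner ℝ Y (θ' v X Z)) :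
    frameCurv e θ u = frameCurv e' θ' (τ u) := by
  have hc : Tendsto τ (𝓝 u) (𝓝 (τ u)) := hτ.continuousAt
  -- The equality `θ = θ' ∘ τ` is to be differentiated, so it must hold near `u`, and its proof
  -- needs derivatives at nearby points. Lowering the order from `∞` to a finite one makes
  -- smoothness at a point an open condition.
  have hdiff : ∀ {E F : Type _} [NormedAddCommGroup E] [NormedSpace ℝ E] [NormedAddCommGroup F]
      [NormedSpace ℝ F] {f : E → F} {x : E}, ContDiffAt ℝ ∞ f x →
      ∀ᶠ y in 𝓝 x, DifferentiableAt ℝ f y := fun hf => by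
    have := (hf.of_le (m := 1) (WithTop.coe_le_coe.mpr le_top)).eventually (by simp)
    exact this.mono fun y hy => hy.differentiableAt (by simp)
  have hsym : ∀ᶠ v in 𝓝 u, ∀ a b, fderiv ℝ (fderiv ℝ τ) v a b = fderiv ℝ (fderiv ℝ τ) v b a := by
    have := (hτ.of_le (m := 2) (WithTop.coe_le_coe.mpr le_top)).eventually (by simp)
    exact this.mono fun y hy => (hy.isSymmSndFDerivAt (by simp)).eq
  -- Brackets of the frame fields are natural under `τ`, and a skew connection form is determined by
  -- them.
  have heq : ∀ᶠ v in 𝓝 u, θ v = θ' (τ v) := by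
    filter_upwards [h.torsion, hc.eventually h'.torsion, he.eventually_nhds, hθ,
      hc.eventually hθ', hc.eventually h'.isUnit, hdiff hτ,
      hdiff (ContDiffAt.fderiv_infty hτ), hdiff h.smooth_frame,
      hc.eventually (hdiff h'.smooth_frame), hsym] with v h1 h2 h3 h4 h5 h6 k1 k2 k3 k4 k5
    have hd : ∀ a Y, fderiv ℝ e' (τ v) (fderiv ℝ τ v a) Y =
        fderiv ℝ (fderiv ℝ τ) v a (e v Y) + fderiv ℝ τ v (fderiv ℝ e v a Y) := by
      intro a Y
      have m1 := (k4.hasFDerivAt.comp v k1.hasFDerivAt).clm_apply (hasFDerivAt_const Y v)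
      have m2 := k2.hasFDerivAt.clm_apply (k3.hasFDerivAt.clm_apply (hasFDerivAt_const Y v))
      have m3 := m1.unique (m2.congr_of_eventuallyEq (h3.mono fun v hv => hv Y))
      simpa [add_comm] using DFunLike.congr_fun m3 a
    have h3' := h3.self_of_nhds
    refine eq_of_skew_of_torsion h4 h5 fun X Y => injective_of_isUnit h6 ?_
    rw [h2, h3', h1, h3', h3', hd, hd, k5 (e v X), map_sub]
    abel
  have hd := (h'.smooth_form.differentiableAt (by simp)).hasFDerivAt.comp u
    (hτ.differentiableAt (by simp)).hasFDerivAt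
  have hd' := (hd.congr_of_eventuallyEq heq).fderiv
  have he0 := he.self_of_nhds
  have ht0 := heq.self_of_nhds
  refine ContinuousLinearMap.ext fun X => ContinuousLinearMap.ext fun Y => ?_
  rw [h.frameCurv_eq, h'.frameCurv_eq, hd', ← ht0, he0, he0]
  rfl

end Frames

/-! ### Smoothness of transition maps, vector fields and metrics, read in a chart. -/

section ChartSmoothness

open Topology Filter

variable {E : Type*} [NormedAddCommGroup E] [NormedSpace ℝ E] {M : Type*} [TopologicalSpace M]
  [ChartedSpace E M] {φ : OpenPartialHomeomorph M E}

lemma mdifferentiable_of_mem (hφ : φ ∈ IsManifold.maximalAtlas 𝓘(ℝ, E) ∞ M) :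
    φ.MDifferentiable 𝓘(ℝ, E) 𝓘(ℝ, E) :=
  ⟨(contMDiffOn_of_mem_maximalAtlas hφ).mdifferentiableOn (by simp),
    (contMDiffOn_symm_of_mem_maximalAtlas hφ).mdifferentiableOn (by simp)⟩

/-- The change of coordinates is smooth. -/
lemma contDiffAt_transition {ψ : OpenPartialHomeomorph M E}
    (hφ : φ ∈ IsManifold.maximalAtlas 𝓘(ℝ, E) ∞ M) (hψ : ψ ∈ IsManifold.maximalAtlas 𝓘(ℝ, E) ∞ M)
    {u : E} (hu : u ∈ φ.target) (hu' : φ.symm u ∈ ψ.source) :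
    ContDiffAt ℝ ∞ (fun v => ψ (φ.symm v)) u :=
  ((contMDiffAt_of_mem_maximalAtlas hψ hu').comp u
    (contMDiffAt_symm_of_mem_maximalAtlas hφ hu)).contDiffAt

lemma fderiv_transition {ψ : OpenPartialHomeomorph M E}
    (hφ : φ ∈ IsManifold.maximalAtlas 𝓘(ℝ, E) ∞ M) (hψ : ψ ∈ IsManifold.maximalAtlas 𝓘(ℝ, E) ∞ M)
    {u : E} (hu : u ∈ φ.target) (hu' : φ.symm u ∈ ψ.source)
    (a : TangentSpace 𝓘(ℝ, E) (φ.symm u)) :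
    fderiv ℝ (fun v => ψ (φ.symm v)) u (mfderiv 𝓘(ℝ, E) 𝓘(ℝ, E) φ (φ.symm u) a) =
      mfderiv 𝓘(ℝ, E) 𝓘(ℝ, E) ψ (φ.symm u) a := by
  have h1 := mfderiv_comp u ((mdifferentiable_of_mem hψ).mdifferentiableAt hu')
    ((mdifferentiable_of_mem hφ).mdifferentiableAt_symm hu)
  have h2 := (mdifferentiable_of_mem hφ).symm_comp_deriv (φ.map_target hu)
  rw [φ.right_inv hu] at h2
  have h3 : fderiv ℝ (fun v => ψ (φ.symm v)) u = mfderiv 𝓘(ℝ, E) 𝓘(ℝ, E) (ψ ∘ φ.symm) u :=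
    mfderiv_eq_fderiv.symm
  rw [h3, h1]
  exact congrArg (mfderiv 𝓘(ℝ, E) 𝓘(ℝ, E) ψ (φ.symm u)) (DFunLike.congr_fun h2 a)

variable [IsManifold 𝓘(ℝ, E) ∞ M]

lemma contMDiffAt_chartInv_apply (hφ : φ ∈ IsManifold.maximalAtlas 𝓘(ℝ, E) ∞ M) {u : E}
    (hu : u ∈ φ.target) (a : E) :
    ContMDiffAt 𝓘(ℝ, E) 𝓘(ℝ, E).tangent ∞
      (fun v => (⟨φ.symm v, mfderiv 𝓘(ℝ, E) 𝓘(ℝ, E) φ.symm v a⟩ : TangentBundle 𝓘(ℝ, E) M)) u := by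
  have h1 := (contMDiffOn_symm_of_mem_maximalAtlas hφ).contMDiffOn_tangentMapWithin (m := ∞)
    (by simp) φ.open_target.uniqueMDiffOn
  have h2 : ContMDiff 𝓘(ℝ, E) 𝓘(ℝ, E).tangent ∞ (fun v : E => (⟨v, a⟩ : TangentBundle 𝓘(ℝ, E) E)) :=
    (contMDiff_vectorSpace_iff_contDiff (V := fun _ => a)).mpr contDiff_const
  have h3 := h1.comp (s := φ.target) h2.contMDiffOn (fun v hv => hv)
  refine (h3.congr fun v hv => ?_).contMDiffAt (φ.open_target.mem_nhds hu)
  simp only [Function.comp_apply, tangentMapWithin]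
  rw [mfderivWithin_of_isOpen φ.open_target hv]

lemma contDiffAt_chart_apply (hφ : φ ∈ IsManifold.maximalAtlas 𝓘(ℝ, E) ∞ M) {u : E}
    (hu : u ∈ φ.target) {U : Set M} (hU : IsOpen U) (hu' : φ.symm u ∈ U)
    {s : ∀ y : M, TangentSpace 𝓘(ℝ, E) y}
    (hs : ContMDiffOn 𝓘(ℝ, E) 𝓘(ℝ, E).tangent ∞ (fun y => (⟨y, s y⟩ : TangentBundle 𝓘(ℝ, E) M)) U) :
    ContDiffAt ℝ ∞
      (fun v => (mfderiv 𝓘(ℝ, E) 𝓘(ℝ, E) φ (φ.symm v) (s (φ.symm v)) : E)) u := by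
  have h1 := (contMDiffOn_of_mem_maximalAtlas hφ).contMDiffOn_tangentMapWithin (m := ∞)
    (by simp) φ.open_source.uniqueMDiffOn
  have h2 := h1.comp (s := φ.source ∩ U) (hs.mono Set.inter_subset_right) (fun v hv => hv.1)
  have h3 := (h2.contMDiffAt ((φ.open_source.inter hU).mem_nhds ⟨φ.map_target hu, hu'⟩)).comp u
    (contMDiffAt_symm_of_mem_maximalAtlas hφ hu)
  have h4 := ((contMDiff_snd_tangentBundle_modelSpace E 𝓘(ℝ, E)).contMDiffAt.comp u h3).contDiffAt
  refine h4.congr_of_eventuallyEq ?_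
  filter_upwards [φ.open_target.mem_nhds hu] with v hv
  have h5 : mfderivWithin 𝓘(ℝ, E) 𝓘(ℝ, E) φ φ.source (φ.symm v) =
      mfderiv 𝓘(ℝ, E) 𝓘(ℝ, E) φ (φ.symm v) :=
    mfderivWithin_of_isOpen φ.open_source (φ.map_target hv)
  exact (DFunLike.congr_fun h5 (s (φ.symm v))).symm

/-- Smoothness of a field of linear maps can be checked on vectors. -/
lemma contDiffAt_clm_of_apply {D F : Type*} [NormedAddCommGroup D] [NormedSpace ℝ D]
    [NormedAddCommGroup F] [NormedSpace ℝ F] [FiniteDimensional ℝ E] {f : D → E →L[ℝ] F} {u : D}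
    (h : ∀ a, ContDiffAt ℝ ∞ (fun v => f v a) u) : ContDiffAt ℝ ∞ f u := by
  let e₁ := ContinuousLinearEquiv.ofFinrankEq
    (Module.finrank_fin_fun ℝ (n := Module.finrank ℝ E)).symm
  let e₂ := (e₁.arrowCongr (1 : F ≃L[ℝ] F)).trans
    (ContinuousLinearEquiv.piRing (Fin (Module.finrank ℝ E)))
  rw [← Function.id_comp f, ← e₂.symm_comp_self]
  exact e₂.symm.contDiff.contDiffAt.comp u (contDiffAt_pi.mpr fun i => h _)

/-- The metric is a smooth section of a bundle of bilinear forms, here pulled back along `f` and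
evaluated on two smooth vector fields along `f`. -/
lemma contDiffAt_metric_apply (g : Bundle.ContMDiffRiemannianMetric 𝓘(ℝ, E) ∞ E
      (fun x : M => TangentSpace 𝓘(ℝ, E) x)) {u : E} {f : E → M}
    {s t : ∀ v : E, TangentSpace 𝓘(ℝ, E) (f v)}
    (hf : ContMDiffAt 𝓘(ℝ, E) 𝓘(ℝ, E) ∞ f u)
    (hs : ContMDiffAt 𝓘(ℝ, E) 𝓘(ℝ, E).tangent ∞
      (fun v => (⟨f v, s v⟩ : TangentBundle 𝓘(ℝ, E) M)) u)
    (ht : ContMDiffAt 𝓘(ℝ, E) 𝓘(ℝ, E).tangent ∞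
      (fun v => (⟨f v, t v⟩ : TangentBundle 𝓘(ℝ, E) M)) u) :
    ContDiffAt ℝ ∞ (fun v => g.inner (f v) (s v) (t v)) u := by
  have h1 : ContMDiffAt 𝓘(ℝ, E) (𝓘(ℝ, E).prod 𝓘(ℝ)) ∞
      (fun v => Bundle.TotalSpace.mk' ℝ (E := Bundle.Trivial M ℝ) (f v)
        (g.inner (f v) (s v) (t v))) u := by
    apply ContMDiffAt.clm_bundle_apply₂ (F₁ := E) (F₂ := E)
    · exact (g.contMDiff (f u)).comp u hf
    · exact hs
    · exact ht
  have h2 := ((Bundle.contMDiffAt_totalSpace).mp h1).2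
  exact h2.contDiffAt

end ChartSmoothness

/-! ### Christoffel symbols of a metric as a smooth form, and the connection form in a frame. -/

section LeviCivita

open Topology Filter

variable {V : Type*} [NormedAddCommGroup V] [InnerProductSpace ℝ V]

/-- The Koszul combination of the derivatives of the metric. -/
def koszulForm (B : V → V →L[ℝ] V →L[ℝ] ℝ) (v : V) : V →L[ℝ] V →L[ℝ] V →L[ℝ] ℝ :=
  (1 / 2 : ℝ) • (fderiv ℝ B v + (fderiv ℝ B v).flip -
    (ContinuousLinearMap.flipₗᵢ ℝ V V ℝ : (V →L[ℝ] V →L[ℝ] ℝ) →L[ℝ] V →L[ℝ] V →L[ℝ] ℝ).comp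
      (fderiv ℝ B v).flip)

/-- The Christoffel symbols of the metric `B`. -/
def christoffelForm (B : V → V →L[ℝ] V →L[ℝ] ℝ) (v : V) : V →L[ℝ] V →L[ℝ] V :=
  (ContinuousLinearMap.compL ℝ V (V →L[ℝ] ℝ) V (B v).inverse).comp (koszulForm B v)

lemma christoffelForm_apply (B : V → V →L[ℝ] V →L[ℝ] ℝ) (v a b : V) :
    christoffelForm B v a b = (B v).inverse ((1 / 2 : ℝ) • (fderiv ℝ B v a b + fderiv ℝ B v b a -
      ((fderiv ℝ B v).flip a).flip b)) := rfl

variable {B : V → V →L[ℝ] V →L[ℝ] ℝ} {u : V}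

/-- The Koszul combination is symmetric once the derivative of the metric is known to be symmetric
in its last two arguments; this is where the symmetry of `B` near `u` enters. -/
lemma christoffelForm_symm (hB : ContDiffAt ℝ ∞ B u)
    (hs : ∀ᶠ v in 𝓝 u, ∀ a b, B v a b = B v b a) (a b : V) :
    christoffelForm B u a b = christoffelForm B u b a := by
  have dB := (hB.differentiableAt (by simp)).hasFDerivAt
  have key : ∀ a b c, fderiv ℝ B u a b c = fderiv ℝ B u a c b := by
    intro a b c
    have h1 := (dB.clm_apply (hasFDerivAt_const b u)).clm_apply (hasFDerivAt_const c u)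
    have h2 := (dB.clm_apply (hasFDerivAt_const c u)).clm_apply (hasFDerivAt_const b u)
    have h3 := h1.unique (h2.congr_of_eventuallyEq (hs.mono fun v hv => hv b c))
    simpa using DFunLike.congr_fun h3 a
  rw [christoffelForm_apply, christoffelForm_apply]
  congr 2
  refine ContinuousLinearMap.ext fun c => ?_
  simp only [add_apply, sub_apply, ContinuousLinearMap.flip_apply, key c a b]
  ring

lemma contDiffAt_christoffelForm [CompleteSpace V] (hB : ContDiffAt ℝ ∞ B u)
    (hi : (B u).IsInvertible) : ContDiffAt ℝ ∞ (christoffelForm B) u := by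
  have h1 := ContDiffAt.fderiv_infty hB
  have h2 := ContDiffAt.clm_flip h1
  have hK : ContDiffAt ℝ ∞ (koszulForm B) u :=
    ((h1.add h2).sub (contDiffAt_const.clm_comp h2)).const_smul (1 / 2 : ℝ)
  obtain ⟨M, hM⟩ := hi
  have h3 : ContDiffAt ℝ ∞ (fun v => (B v).inverse) u := by
    have h4 : ContDiffAt ℝ ∞ (ContinuousLinearMap.inverse (R := ℝ) (M := V) (M₂ := V →L[ℝ] ℝ))
      (B u) := hM ▸ contDiffAt_map_inverse M
    exact h4.comp u hB
  exact ((ContinuousLinearMap.contDiff _).contDiffAt.comp u h3).clm_comp hK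

/-- The connection form, in the frame `e`, of the connection with Christoffel symbols `Γ`. -/
def frameForm (Γ : V → V →L[ℝ] V →L[ℝ] V) (e : V → V →L[ℝ] V) (v : V) : V →L[ℝ] V →L[ℝ] V :=
  (ContinuousLinearMap.compL ℝ V V V (Ring.inverse (e v))).comp
    ((fderiv ℝ e v + ((ContinuousLinearMap.compL ℝ V V V).flip (e v)).comp (Γ v)).comp (e v))

lemma frameForm_apply (Γ : V → V →L[ℝ] V →L[ℝ] V) (e : V → V →L[ℝ] V) (v X Y : V) :
    frameForm Γ e v X Y =
      Ring.inverse (e v) (fderiv ℝ e v (e v X) Y + Γ v (e v X) (e v Y)) := rfl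

lemma isFrameConnection_leviCivita [CompleteSpace V] {e : V → V →L[ℝ] V}
    (hB : ∀ᶠ v in 𝓝 u, ContDiffAt ℝ ∞ B v)
    (hs : ∀ᶠ v in 𝓝 u, ∀ a b, B v a b = B v b a) (hi : (B u).IsInvertible)
    (he : ContDiffAt ℝ ∞ e u) (hu : ∀ᶠ v in 𝓝 u, IsUnit (e v)) :
    IsFrameConnection (christoffelForm B) e (frameForm (christoffelForm B) e) u where
  smooth_christoffel := contDiffAt_christoffelForm hB.self_of_nhds hi
  symm := by
    filter_upwards [hB, hs.eventually_nhds] with v h1 h2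
    exact christoffelForm_symm h1 h2
  smooth_frame := he
  smooth_form := by
    obtain ⟨x, hx⟩ := hu.self_of_nhds
    have h1 : ContDiffAt ℝ ∞ Ring.inverse (e u) := hx ▸ contDiffAt_ringInverse ℝ x
    have h2 := h1.comp u he
    have h3 := (ContinuousLinearMap.contDiff (ContinuousLinearMap.compL ℝ V V V)).contDiffAt.comp
      u h2
    have h4 := (ContinuousLinearMap.contDiff
      (ContinuousLinearMap.compL ℝ V V V).flip).contDiffAt.comp u he
    exact h3.clm_comp (((ContDiffAt.fderiv_infty he).add (h4.clm_comp
      (contDiffAt_christoffelForm hB.self_of_nhds hi))).clm_comp he)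
  isUnit := hu
  eq := by
    filter_upwards [hu] with v h1 X Y
    rw [frameForm_apply, (isUnit_clm h1).2]

lemma curvForm_apply_eq {Γ : V → V →L[ℝ] V →L[ℝ] V} (hΓ : ContDiffAt ℝ ∞ Γ u) (a b c : V) :
    curvForm Γ u a b c = fderiv ℝ (fun v => Γ v b c) u a - fderiv ℝ (fun v => Γ v a c) u b +
      Γ u a (Γ u b c) - Γ u b (Γ u a c) := by
  have dΓ := (hΓ.differentiableAt (by simp)).hasFDerivAt
  have key : ∀ a b c, fderiv ℝ (fun v => Γ v b c) u a = fderiv ℝ Γ u a b c := by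
    intro a b c
    rw [((dΓ.clm_apply (hasFDerivAt_const b u)).clm_apply (hasFDerivAt_const c u)).fderiv]
    simp
  rw [key, key, curvForm_apply]
  simp only [add_apply, sub_apply, mul_apply_eq_comp]
  abel

end LeviCivita

/-! ### The curvature in terms of the intrinsic torsion `ξ = π ∘ θ` and a remainder. -/

section TorsionDecomposition

open Topology Filter

variable {V : Type*} [NormedAddCommGroup V] [InnerProductSpace ℝ V]

/-- Forget the continuity of a trilinear map. -/
def toLin₃ : (V →L[ℝ] V →L[ℝ] V →L[ℝ] V) →ₗ[ℝ] (V →ₗ[ℝ] V →ₗ[ℝ] V →ₗ[ℝ] V) where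
  toFun f := toLin₂ ∘ₗ (f : V →ₗ[ℝ] V →L[ℝ] V →L[ℝ] V)
  map_add' _ _ := rfl
  map_smul' _ _ := rfl

@[simp] lemma toLin₃_apply (f : V →L[ℝ] V →L[ℝ] V →L[ℝ] V) (X Y Z : V) :
    toLin₃ f X Y Z = f X Y Z := rfl

/-- The component of a form with values in the endomorphisms that remains after a projection. -/
def remainder (π : (V →L[ℝ] V) →L[ℝ] V →L[ℝ] V) : (V →L[ℝ] V) →L[ℝ] V →L[ℝ] V :=
  ContinuousLinearMap.id ℝ _ - π

lemma remainder_apply (π : (V →L[ℝ] V) →L[ℝ] V →L[ℝ] V) (A : V →L[ℝ] V) :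
    remainder π A = A - π A := rfl

variable (π : (V →L[ℝ] V) →L[ℝ] V →L[ℝ] V) (e : V → V →L[ℝ] V) (θ : V → V →L[ℝ] V →L[ℝ] V) (u : V)

/-- The derivative of the component `π ∘ θ` of the connection form `θ`, covariant with respect to
the connection with connection form `θ - π ∘ θ`. -/
def torsionDeriv : V →L[ℝ] V →L[ℝ] V →L[ℝ] V :=
  (ContinuousLinearMap.compL ℝ V (V →L[ℝ] V) (V →L[ℝ] V) π).comp ((fderiv ℝ θ u).comp (e u)) +
    (mulForm ((remainder π).comp (θ u)) (π.comp (θ u)) -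
    (mulForm (π.comp (θ u)) ((remainder π).comp (θ u))).flip -
    (ContinuousLinearMap.compL ℝ V V (V →L[ℝ] V) (π.comp (θ u))).comp
      ((remainder π).comp (θ u)))

lemma torsionDeriv_apply (X Y Z : V) : torsionDeriv π e θ u X Y Z =
    π (fderiv ℝ θ u (e u X) Y) Z + (remainder π (θ u X) (π (θ u Y) Z) -
      π (θ u Y) (remainder π (θ u X) Z) - π (θ u (remainder π (θ u X) Y)) Z) := rfl

/-- The part of the curvature that the component `π ∘ θ` of the connection form does not
determine. -/
def curvRemainder : V →L[ℝ] V →L[ℝ] V →L[ℝ] V :=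
  let T := (ContinuousLinearMap.compL ℝ V V (V →L[ℝ] V) (π.comp (θ u))).comp (π.comp (θ u))
  let Q := mulForm (π.comp (θ u)) (π.comp (θ u))
  frameCurv e θ u - (torsionDeriv π e θ u - (torsionDeriv π e θ u).flip) -
    (Q - Q.flip - (T - T.flip))

lemma frameCurv_decomposition (X Y Z : V) : frameCurv e θ u X Y Z =
    torsionDeriv π e θ u X Y Z - torsionDeriv π e θ u Y X Z +
      (π (θ u X) (π (θ u Y) Z) - π (θ u Y) (π (θ u X) Z) -
        (π (θ u (π (θ u X) Y)) Z - π (θ u (π (θ u Y) X)) Z)) + curvRemainder π e θ u X Y Z := by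
  have h : curvRemainder π e θ u X Y Z = frameCurv e θ u X Y Z -
      (torsionDeriv π e θ u X Y Z - torsionDeriv π e θ u Y X Z) -
      (π (θ u X) (π (θ u Y) Z) - π (θ u Y) (π (θ u X) Z) -
        (π (θ u (π (θ u X) Y)) Z - π (θ u (π (θ u Y) X)) Z)) := rfl
  rw [h]
  abel

lemma frameCurv_swap (X Y Z : V) : frameCurv e θ u X Y Z = - frameCurv e θ u Y X Z := by
  rw [frameCurv_apply, frameCurv_apply, curvForm_swap]
  rfl

variable {e θ u} {Γ : V → V →L[ℝ] V →L[ℝ] V}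

/-- Substituting `θ = πθ + (1 - π)θ` in the structure equation, the mixed terms are exactly those in
`torsionDeriv`. What is left involves only `1 - π` and brackets of its values, so it will lie in
`𝔤`. -/
lemma IsFrameConnection.curvRemainder_eq [CompleteSpace V] (h : IsFrameConnection Γ e θ u)
    (X Y : V) : curvRemainder π e θ u X Y =
      remainder π (fderiv ℝ θ u (e u X) Y) - remainder π (fderiv ℝ θ u (e u Y) X) +
      (remainder π (θ u X) * remainder π (θ u Y) - remainder π (θ u Y) * remainder π (θ u X)) -
      remainder π (θ u (θ u X Y - θ u Y X)) := by
  refine ContinuousLinearMap.ext fun Z => ?_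
  have h1 := frameCurv_decomposition π e θ u X Y Z
  rw [h.frameCurv_eq, torsionDeriv_apply, torsionDeriv_apply] at h1
  rw [← sub_eq_iff_eq_add'] at h1
  rw [← h1]
  simp only [remainder_apply, add_apply, sub_apply, mul_apply_eq_comp, map_sub]
  abel

lemma curvRemainder_swap (X Y Z : V) :
    curvRemainder π e θ u X Y Z = - curvRemainder π e θ u Y X Z := by
  have h1 := frameCurv_decomposition π e θ u X Y Z
  have h2 := frameCurv_decomposition π e θ u Y X Z
  rw [← sub_eq_iff_eq_add'] at h1 h2
  rw [← h1, ← h2, frameCurv_swap]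
  abel

/-- Skew-symmetry is a linear condition with constant coefficients, so it may be differentiated. -/
lemma inner_fderiv_skew (hθ : DifferentiableAt ℝ θ u)
    (hs : ∀ᶠ v in 𝓝 u, ∀ X Y Z, inner ℝ (θ v X Y) Z = - inner ℝ Y (θ v X Z)) (a X Y Z : V) :
    inner ℝ (fderiv ℝ θ u a X Y) Z = - inner ℝ Y (fderiv ℝ θ u a X Z) := by
  have d := fun Y => (hθ.hasFDerivAt.clm_apply (hasFDerivAt_const X u)).clm_apply
    (hasFDerivAt_const Y u)
  have h1 := (d Y).inner ℝ (hasFDerivAt_const Z u)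
  have h2 := ((hasFDerivAt_const Y u).inner ℝ (d Z)).neg
  have h3 := DFunLike.congr_fun
    (h1.unique (h2.congr_of_eventuallyEq (hs.mono fun v hv => hv X Y Z))) a
  simpa [fderivInnerCLM_apply] using h3

lemma IsFrameConnection.inner_frameCurv [CompleteSpace V] (h : IsFrameConnection Γ e θ u)
    (hs : ∀ᶠ v in 𝓝 u, ∀ X Y Z, inner ℝ (θ v X Y) Z = - inner ℝ Y (θ v X Z)) (X Y Z T : V) :
    inner ℝ (frameCurv e θ u X Y Z) T = - inner ℝ Z (frameCurv e θ u X Y T) := by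
  have h1 := inner_fderiv_skew (h.smooth_form.differentiableAt (by simp)) hs
  have h2 := hs.self_of_nhds
  rw [h.frameCurv_eq]
  simp only [add_apply, sub_apply, mul_apply_eq_comp, inner_add_left, inner_sub_left,
    inner_add_right, inner_sub_right, h1, h2]
  ring

/-- The covariant derivative of the curvature is skew-symmetric. -/
lemma IsFrameConnection.inner_frameCurvDeriv [CompleteSpace V] (h : IsFrameConnection Γ e θ u)
    (hs : ∀ X Y Z, inner ℝ (θ u X Y) Z = - inner ℝ Y (θ u X Z))
    (hR : ∀ᶠ v in 𝓝 u, ∀ X Y Z T,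
      inner ℝ (frameCurv e θ v X Y Z) T = - inner ℝ Z (frameCurv e θ v X Y T)) (U X Y Z T : V) :
    inner ℝ (frameCurvDeriv e θ u U X Y Z) T = - inner ℝ Z (frameCurvDeriv e θ u U X Y T) := by
  have d := ((h.smooth_frameCurv.differentiableAt (by simp)).hasFDerivAt).clm_apply
    (hasFDerivAt_const X u)
  have h0 : ∀ᶠ v in 𝓝 u, ∀ Y Z T,
      inner ℝ (frameCurv e θ v X Y Z) T = - inner ℝ Z (frameCurv e θ v X Y T) :=
    hR.mono fun v hv => hv X
  have h1 := inner_fderiv_skew d.differentiableAt h0 (e u U) Y Z T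
  rw [d.fderiv] at h1
  have h2 : inner ℝ (fderiv ℝ (frameCurv e θ) u (e u U) X Y Z) T =
      - inner ℝ Z (fderiv ℝ (frameCurv e θ) u (e u U) X Y T) := by simpa using h1
  have h3 := hR.self_of_nhds
  simp only [frameCurvDeriv_apply, inner_add_left, inner_sub_left, inner_add_right,
    inner_sub_right, h2, hs, h3]
  ring

lemma IsFrameConnection.frameCurvDeriv_swap [CompleteSpace V] (h : IsFrameConnection Γ e θ u)
    (U X Y Z : V) : frameCurvDeriv e θ u U X Y Z = - frameCurvDeriv e θ u U Y X Z := by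
  have d := fun X Y => (((h.smooth_frameCurv.differentiableAt (by simp)).hasFDerivAt).clm_apply
    (hasFDerivAt_const X u)).clm_apply (hasFDerivAt_const Y u)
  have h1 : HasFDerivAt (fun v => - frameCurv e θ v Y X) _ u := (d Y X).neg
  have h2 : ∀ v, frameCurv e θ v X Y = - frameCurv e θ v Y X := fun v =>
    ContinuousLinearMap.ext fun Z => frameCurv_swap e θ v X Y Z
  have h3 := DFunLike.congr_fun (DFunLike.congr_fun
    ((d X Y).unique (h1.congr_of_eventuallyEq (Eventually.of_forall h2))) (e u U)) Z
  have h4 : fderiv ℝ (frameCurv e θ) u (e u U) X Y Z =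
      - fderiv ℝ (frameCurv e θ) u (e u U) Y X Z := by simpa using h3
  rw [frameCurvDeriv_apply, frameCurvDeriv_apply, h4, frameCurv_swap e θ u X Y,
    frameCurv_swap e θ u X Y (θ u U Z), frameCurv_swap e θ u (θ u U X),
    frameCurv_swap e θ u X (θ u U Y), map_neg]
  abel

end TorsionDecomposition

/-! ### Ricci curvature in a frame, and Schur's lemma. -/

section PointwiseEinstein

open Topology Filter

variable {n : ℕ} {G : Subgroup (Vec n ≃ₗᵢ[ℝ] Vec n)} {e : Vec n → Vec n →L[ℝ] Vec n}
  {θ Γ : Vec n → Vec n →L[ℝ] Vec n →L[ℝ] Vec n} {u : Vec n}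

/-- The component of the connection form `θ` with values in `𝔤^⊥` belongs to `W`. -/
def TorsionFormIn (W : Subrepresentation (tensorRep G)) (T : Vec n →L[ℝ] Vec n →L[ℝ] Vec n) :
    Prop :=
  ∃ ξ ∈ W.toSubmodule, (∀ X, ξ X ∈ lieAlgPerp G) ∧
    ∀ X, ∃ A ∈ lieAlg G, ∀ Y, T X Y = ξ X Y + A Y

/-- Both parts of `T` take values in `𝔰𝔬(n)`. Applied to the connection form in a section of `P`,
this supplies the metric compatibility of the connection. -/
lemma TorsionFormIn.skew {W : Subrepresentation (tensorRep G)}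
    {T : Vec n →L[ℝ] Vec n →L[ℝ] Vec n} (h : TorsionFormIn W T) (X Y Z : Vec n) :
    inner ℝ (T X Y) Z = - inner ℝ Y (T X Z) := by
  obtain ⟨ξ, -, h1, h2⟩ := h
  obtain ⟨A, hA, h3⟩ := h2 X
  rw [h3, h3, inner_add_left, inner_add_right, (h1 X).1, skew_of_mem_lieAlg hA]
  ring

/-- The tensor `ξ` is given point by point, with no regularity. Since it equals `π ∘ T` for a fixed
linear `π`, it depends smoothly on the point whenever `T` does. -/
lemma TorsionFormIn.projection {W : Subrepresentation (tensorRep G)}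
    {T : Vec n →L[ℝ] Vec n →L[ℝ] Vec n} (h : TorsionFormIn W T)
    {π : (Vec n →L[ℝ] Vec n) →L[ℝ] Vec n →L[ℝ] Vec n}
    (hπ : ∀ A B : Vec n →L[ℝ] Vec n, (A : Vec n →ₗ[ℝ] Vec n) ∈ lieAlgPerp G →
        (B : Vec n →ₗ[ℝ] Vec n) ∈ lieAlg G → π (A + B) = A) :
    toLin₂ (π.comp T) ∈ W.toSubmodule ∧
      ∀ X, (remainder π (T X) : Vec n →ₗ[ℝ] Vec n) ∈ lieAlg G := by
  obtain ⟨ξ, hξ, h1, h2⟩ := h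
  have key : ∀ X, ∃ A ∈ lieAlg G, T X = LinearMap.toContinuousLinearMap (ξ X) +
      LinearMap.toContinuousLinearMap A ∧ π (T X) = LinearMap.toContinuousLinearMap (ξ X) := by
    intro X
    obtain ⟨A, hA, h3⟩ := h2 X
    have h4 : T X = LinearMap.toContinuousLinearMap (ξ X) +
        LinearMap.toContinuousLinearMap A := ContinuousLinearMap.ext fun Y => h3 Y
    exact ⟨A, hA, h4, by rw [h4]; exact hπ _ _ (h1 X) hA⟩
  constructor
  · have h5 : toLin₂ (π.comp T) = ξ := LinearMap.ext₂ fun X Y => by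
      obtain ⟨A, hA, h4, h6⟩ := key X
      exact DFunLike.congr_fun h6 Y
    rw [h5]
    exact hξ
  · intro X
    obtain ⟨A, hA, h4, h6⟩ := key X
    have h7 : remainder π (T X) = LinearMap.toContinuousLinearMap A := by
      rw [remainder_apply, h6, h4, add_sub_cancel_left]
    rw [h7]
    exact hA

/-- Under the hypotheses on invariants, the Ricci curvature is a multiple of the metric at each
point where the intrinsic torsion takes values in `W`. -/
theorem IsFrameConnection.tfRic_eq_zero {W : Subrepresentation (tensorRep G)}
    (ha : NoInvariants G (((stdRep G).tprod W.toRepresentation).tprod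
      (traceFreeSym G).toRepresentation))
    (hb : NoInvariants G ((symSquare G W.toRepresentation).toRepresentation.tprod
      (traceFreeSym G).toRepresentation))
    (hc : NoInvariants G ((algCurv G).toRepresentation.tprod
      (traceFreeSym G).toRepresentation))
    (h : IsFrameConnection Γ e θ u) (hW : ∀ᶠ v in 𝓝 u, TorsionFormIn W (θ v)) :
    tfRic (toLin₃ (frameCurv e θ u)) = 0 := by
  obtain ⟨π', hπ'⟩ := exists_perp_projection G
  let π : (Vec n →L[ℝ] Vec n) →L[ℝ] Vec n →L[ℝ] Vec n := LinearMap.toContinuousLinearMap π'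
  have hπ : ∀ A B : Vec n →L[ℝ] Vec n, (A : Vec n →ₗ[ℝ] Vec n) ∈ lieAlgPerp G →
        (B : Vec n →ₗ[ℝ] Vec n) ∈ lieAlg G → π (A + B) = A := hπ'
  have dθ := (h.smooth_form.differentiableAt (by simp)).hasFDerivAt
  have m0 := fun v (hv : TorsionFormIn W (θ v)) => hv.projection hπ
  -- `πθ` stays in `W` and `(1 - π)θ` in `V ⊗ 𝔤` near `u`; both are fixed subspaces, so their
  -- derivatives stay there too.
  have m1 : ∀ a, toLin₂ (π.comp (fderiv ℝ θ u a)) ∈ W.toSubmodule := fun a =>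
    HasFDerivAt.mem_of_eventually_mem (N := Vec n →L[ℝ] Vec n →L[ℝ] Vec n)
      (toLin₂ ∘ₗ (ContinuousLinearMap.compL ℝ (Vec n) (Vec n →L[ℝ] Vec n) (Vec n →L[ℝ] Vec n) π :
        (Vec n →L[ℝ] Vec n →L[ℝ] Vec n) →ₗ[ℝ] (Vec n →L[ℝ] Vec n →L[ℝ] Vec n)))
      W.toSubmodule dθ (hW.mono fun v hv => (m0 v hv).1) a
  have m2 : ∀ a Y, (remainder π (fderiv ℝ θ u a Y) : Vec n →ₗ[ℝ] Vec n) ∈ lieAlg G := fun a Y =>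
    HasFDerivAt.mem_of_eventually_mem (N := Vec n →L[ℝ] Vec n)
      (ContinuousLinearMap.coeLM ℝ ∘ₗ (remainder π : (Vec n →L[ℝ] Vec n) →ₗ[ℝ] Vec n →L[ℝ] Vec n))
      (lieAlg G) ((dθ.clm_apply (hasFDerivAt_const Y u)).congr_fderiv (f' := _)
        (g' := (fderiv ℝ θ u).flip Y) (by ext; simp))
      (hW.mono fun v hv => (m0 v hv).2 Y) a
  have hu := m0 u hW.self_of_nhds
  refine GStructures.tfRic_eq_zero ha hb hc (ξ := toLin₂ (π.comp (θ u)))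
    (D := toLin₃ (torsionDeriv π e θ u)) (S := toLin₃ (curvRemainder π e θ u)) hu.1
    (fun X => ?_) ?_ ?_ fun X Y Z => frameCurv_decomposition π e θ u X Y Z
  · have h1 : ∀ (a b c : Vec n →ₗ[ℝ] Vec n →ₗ[ℝ] Vec n), b ∈ W.toSubmodule → c ∈ W.toSubmodule →
      a = b + c → a ∈ W.toSubmodule := fun a b c hb hc ha => ha ▸ W.toSubmodule.add_mem hb hc
    -- The covariant derivative of `ξ` is its plain derivative plus `ζ = A_X · ξ`, where `A_X = (1 -
    -- π)(θ X)` belongs to `𝔤`.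
    let ζ : Vec n →L[ℝ] Vec n →L[ℝ] Vec n := mulForm ((remainder π).comp (θ u)) (π.comp (θ u)) X -
      (mulForm (π.comp (θ u)) ((remainder π).comp (θ u))).flip X -
      (π.comp (θ u)).comp (remainder π (θ u X))
    exact h1 _ _ _ (m1 (e u X)) (lieAlg_smul_mem W (hu.2 X) hu.1 (ζ := toLin₂ ζ)
      fun Y Z => rfl) rfl
  · refine ⟨fun X Y => LinearMap.ext fun Z => curvRemainder_swap π X Y Z, fun X Y => ?_⟩
    have h1 : toLin₃ (curvRemainder π e θ u) X Y =
      (curvRemainder π e θ u X Y : Vec n →ₗ[ℝ] Vec n) := rfl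
    rw [h1, h.curvRemainder_eq]
    exact (lieAlg G).sub_mem ((lieAlg G).add_mem ((lieAlg G).sub_mem (m2 _ _) (m2 _ _))
      (bracket_mem_lieAlg (hu.2 X) (hu.2 Y))) (hu.2 _)
  · refine LinearMap.ext fun X => LinearMap.ext₂ fun Y Z => ?_
    exact h.bianchi X Y Z

/-- The Einstein constant of a curvature tensor. -/
def einsteinConst : (Vec n →L[ℝ] Vec n →L[ℝ] Vec n →L[ℝ] Vec n) →ₗ[ℝ] ℝ :=
  (n : ℝ)⁻¹ • (formTrace ∘ₗ ric ∘ₗ toLin₃)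

/-- `tfRic` sees only the symmetric part of the contraction; the symmetries of the Levi-Civita
curvature make Ricci symmetric, so nothing else is left. -/
theorem IsFrameConnection.ric_eq {W : Subrepresentation (tensorRep G)}
    (ha : NoInvariants G (((stdRep G).tprod W.toRepresentation).tprod
      (traceFreeSym G).toRepresentation))
    (hb : NoInvariants G ((symSquare G W.toRepresentation).toRepresentation.tprod
      (traceFreeSym G).toRepresentation))
    (hc : NoInvariants G ((algCurv G).toRepresentation.tprod
      (traceFreeSym G).toRepresentation))
    (h : IsFrameConnection Γ e θ u) (hW : ∀ᶠ v in 𝓝 u, TorsionFormIn W (θ v)) (Y Z : Vec n) :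
    ric (toLin₃ (frameCurv e θ u)) Y Z = einsteinConst (frameCurv e θ u) * inner ℝ Y Z := by
  rw [ric_eq_of_tfRic_eq_zero (R := toLin₃ (frameCurv e θ u))
    (fun X Y Z => frameCurv_swap e θ u X Y Z)
    (fun X Y Z T => h.inner_frameCurv (hW.mono fun v hv => hv.skew) X Y Z T)
    (LinearMap.ext fun X => LinearMap.ext₂ fun Y Z => h.bianchi X Y Z)
    (h.tfRic_eq_zero ha hb hc hW), div_eq_inv_mul]
  rfl

lemma sum_inner_comp_comm (A B : Vec n →ₗ[ℝ] Vec n) :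
    ∑ i, inner ℝ (sb i) (A (B (sb i))) = ∑ i, inner ℝ (sb i) (B (A (sb i))) := by
  have h1 : LinearMap.trace ℝ (Vec n) (A ∘ₗ B) = LinearMap.trace ℝ (Vec n) (B ∘ₗ A) :=
    LinearMap.trace_comp_comm' _ _
  rw [trace_eq_sum_sb, trace_eq_sum_sb] at h1
  exact (Finset.sum_congr rfl fun i _ => real_inner_comm _ _).trans (h1.trans
    (Finset.sum_congr rfl fun i _ => real_inner_comm _ _))

lemma linear_fderiv_of_eventually_eq {N X : Type*} [NormedAddCommGroup N] [NormedSpace ℝ N]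
    [FiniteDimensional ℝ N] [NormedAddCommGroup X] [NormedSpace ℝ X] (L l : N →ₗ[ℝ] ℝ) {c : ℝ}
    {F : X → N} {F' : X →L[ℝ] N} {x : X} (hF : HasFDerivAt F F' x)
    (h : ∀ᶠ y in 𝓝 x, L (F y) = l (F y) * c) (a : X) :
    L (F' a) = fderiv ℝ (fun y => l (F y)) x a * c := by
  have dl : HasFDerivAt (fun y => l (F y)) _ x :=
    (LinearMap.toContinuousLinearMap l).hasFDerivAt.comp x hF
  have dL : HasFDerivAt (fun y => L (F y)) _ x :=
    (LinearMap.toContinuousLinearMap L).hasFDerivAt.comp x hF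
  have h1 := DFunLike.congr_fun (dL.unique ((dl.mul_const c).congr_of_eventuallyEq h)) a
  rw [dl.fderiv]
  exact h1.trans (mul_comm _ _)

/-- The covariant derivative of the Ricci curvature of an Einstein metric. -/
lemma IsFrameConnection.ric_frameCurvDeriv (h : IsFrameConnection Γ e θ u)
    (hs : ∀ X Y Z, inner ℝ (θ u X Y) Z = - inner ℝ Y (θ u X Z))
    (hE : ∀ᶠ v in 𝓝 u, ∀ Y Z, ric (toLin₃ (frameCurv e θ v)) Y Z =
      einsteinConst (frameCurv e θ v) * inner ℝ Y Z) (U Y Z : Vec n) :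
    ric (toLin₃ (frameCurvDeriv e θ u U)) Y Z =
      fderiv ℝ (fun v => einsteinConst (frameCurv e θ v)) u (e u U) * inner ℝ Y Z := by
  have dR := (h.smooth_frameCurv.differentiableAt (by simp)).hasFDerivAt
  have h3 : ric (toLin₃ (fderiv ℝ (frameCurv e θ) u (e u U))) Y Z = _ :=
    linear_fderiv_of_eventually_eq (LinearMap.applyₗ Z ∘ₗ LinearMap.applyₗ Y ∘ₗ ric ∘ₗ
    toLin₃ (V := Vec n)) einsteinConst dR (hE.mono fun v hv => hv Y Z) (e u U)
  -- Contraction commutes with the covariant derivative: these two terms cancel because `tr(AB) =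
  -- tr(BA)`. The terms with `θ u U Y` and `θ u U Z` cancel because Ricci is a multiple of the inner
  -- product and `θ u U` is skew.
  have h5 : ∑ i, inner ℝ (sb i) (θ u U (frameCurv e θ u (sb i) Y Z)) =
      ∑ i, inner ℝ (sb i) (frameCurv e θ u (θ u U (sb i)) Y Z) :=
    sum_inner_comp_comm (θ u U : Vec n →ₗ[ℝ] Vec n)
      (LinearMap.applyₗ Z ∘ₗ LinearMap.applyₗ Y ∘ₗ toLin₃ (frameCurv e θ u))
  have h6 := hE.self_of_nhds
  refine Eq.trans ?_ h3
  have h7 := h6 (θ u U Y) Z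
  have h8 := h6 Y (θ u U Z)
  rw [ric_apply] at h7 h8 ⊢
  rw [ric_apply]
  simp only [toLin₃_apply] at h7 h8
  simp only [toLin₃_apply, frameCurvDeriv_apply, inner_add_right, inner_sub_right,
    Finset.sum_add_distrib, Finset.sum_sub_distrib]
  rw [h5, h7, h8, hs]
  ring

/-- Schur's lemma. -/
theorem IsFrameConnection.fderiv_einsteinConst (h : IsFrameConnection Γ e θ u)
    (hs : ∀ X Y Z, inner ℝ (θ u X Y) Z = - inner ℝ Y (θ u X Z))
    (hR : ∀ᶠ v in 𝓝 u, ∀ X Y Z T,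
      inner ℝ (frameCurv e θ v X Y Z) T = - inner ℝ Z (frameCurv e θ v X Y T))
    (hE : ∀ᶠ v in 𝓝 u, ∀ Y Z, ric (toLin₃ (frameCurv e θ v)) Y Z =
      einsteinConst (frameCurv e θ v) * inner ℝ Y Z) (hn : n ≠ 2) :
    fderiv ℝ (fun v => einsteinConst (frameCurv e θ v)) u = 0 := by
  have h1 := eq_zero_of_contracted_bianchi (D := fun U => toLin₃ (frameCurvDeriv e θ u U))
    (l := (fderiv ℝ (fun v => einsteinConst (frameCurv e θ v)) u ∘L e u : Vec n →ₗ[ℝ] ℝ))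
    (fun U X Y Z => h.frameCurvDeriv_swap U X Y Z)
    (fun U X Y Z T => h.inner_frameCurvDeriv hs hR U X Y Z T)
    (fun U X Y Z => h.second_bianchi U X Y Z) (fun U Y Z => h.ric_frameCurvDeriv hs hE U Y Z) hn
  refine ContinuousLinearMap.ext fun a => ?_
  have h2 := h1 (Ring.inverse (e u) a)
  rw [← (isUnit_clm h.isUnit.self_of_nhds).2 a]
  exact h2

end PointwiseEinstein

/-! ### Invertibility in finite dimension. -/

section FiniteDimensionalInverses

variable {V : Type*} [NormedAddCommGroup V] [NormedSpace ℝ V] [FiniteDimensional ℝ V]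

lemma isUnit_of_injective {f : V →L[ℝ] V} (hf : Function.Injective f) : IsUnit f := by
  have : CompleteSpace V := FiniteDimensional.complete ℝ V
  exact ContinuousLinearMap.isUnit_iff_bijective.mpr
    ⟨hf, LinearMap.injective_iff_surjective (f := (f : V →ₗ[ℝ] V)).mp hf⟩

lemma isInvertible_of_pos {B : V →L[ℝ] V →L[ℝ] ℝ} (hB : ∀ a, a ≠ 0 → 0 < B a a) :
    B.IsInvertible := by
  have h1 : Function.Injective (B : V →ₗ[ℝ] V →L[ℝ] ℝ) := by
    refine (injective_iff_map_eq_zero _).mpr fun a ha => ?_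
    by_contra h
    have h2 := hB a h
    have h3 : B a = 0 := ha
    simp [h3] at h2
  have h2 : Module.finrank ℝ V = Module.finrank ℝ (V →L[ℝ] ℝ) :=
    (Subspace.dual_finrank_eq (K := ℝ) (V := V)).symm.trans
      (LinearMap.toContinuousLinearMap : (V →ₗ[ℝ] ℝ) ≃ₗ[ℝ] (V →L[ℝ] ℝ)).finrank_eq
  exact ⟨(LinearMap.linearEquivOfInjective _ h1 h2).toContinuousLinearEquiv,
    ContinuousLinearMap.ext fun _ => rfl⟩

end FiniteDimensionalInverses

/-! ### Sections of the `G`-structure seen in a chart. -/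

section ChartFrames

open Topology Filter

variable {n : ℕ} {M : Type*} [TopologicalSpace M] [ChartedSpace (Vec n) M]
  {φ : OpenPartialHomeomorph M (Vec n)}

lemma mfderiv_chartInvDeriv (hφ : φ ∈ IsManifold.maximalAtlas 𝓘(ℝ, Vec n) ∞ M) {u : Vec n}
    (hu : u ∈ φ.target) (a : Vec n) :
    mfderiv 𝓘(ℝ, Vec n) 𝓘(ℝ, Vec n) φ (φ.symm u) (chartInvDeriv φ u a) = a :=
  DFunLike.congr_fun ((mdifferentiable_of_mem hφ).comp_symm_deriv hu) a

lemma chartInvDeriv_mfderiv (hφ : φ ∈ IsManifold.maximalAtlas 𝓘(ℝ, Vec n) ∞ M) {u : Vec n}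
    (hu : u ∈ φ.target) (a : TangentSpace 𝓘(ℝ, Vec n) (φ.symm u)) :
    chartInvDeriv φ u (mfderiv 𝓘(ℝ, Vec n) 𝓘(ℝ, Vec n) φ (φ.symm u) a) = a := by
  have h2 := (mdifferentiable_of_mem hφ).symm_comp_deriv (φ.map_target hu)
  rw [φ.right_inv hu] at h2
  exact DFunLike.congr_fun h2 a

lemma frameInChart_apply_chart {s : ∀ y : M, Vec n →L[ℝ] TangentSpace 𝓘(ℝ, Vec n) y}
    {x : M} (hx : x ∈ φ.source) (Y : Vec n) :
    frameInChart φ s (φ x) Y = mfderiv 𝓘(ℝ, Vec n) 𝓘(ℝ, Vec n) φ x (s x Y) := by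
  rw [frameInChart, φ.left_inv hx]
  rfl

variable [IsManifold 𝓘(ℝ, Vec n) ∞ M] {g : RiemMetric n M}

lemma coordMetric_symm (u a b : Vec n) : coordMetric g φ u a b = coordMetric g φ u b a :=
  g.symm _ _ _

lemma coordMetric_pos (hφ : φ ∈ IsManifold.maximalAtlas 𝓘(ℝ, Vec n) ∞ M) {u : Vec n}
    (hu : u ∈ φ.target) {a : Vec n} (ha : a ≠ 0) : 0 < coordMetric g φ u a a := by
  refine g.pos _ _ fun h => ha ?_
  rw [← mfderiv_chartInvDeriv hφ hu a, h]
  exact map_zero _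

lemma contDiffAt_coordMetric (hφ : φ ∈ IsManifold.maximalAtlas 𝓘(ℝ, Vec n) ∞ M) {u : Vec n}
    (hu : u ∈ φ.target) : ContDiffAt ℝ ∞ (coordMetric g φ) u :=
  contDiffAt_clm_of_apply fun a => contDiffAt_clm_of_apply fun b =>
    contDiffAt_metric_apply g (contMDiffAt_symm_of_mem_maximalAtlas hφ hu)
      (contMDiffAt_chartInv_apply hφ hu a) (contMDiffAt_chartInv_apply hφ hu b)

variable {G : Subgroup (Vec n ≃ₗᵢ[ℝ] Vec n)} {P : GStructure g G} {U : Set M}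
  {s : ∀ y : M, Vec n →L[ℝ] TangentSpace 𝓘(ℝ, Vec n) y} {u : Vec n}

lemma GStructure.IsSection.eventually_mem (hs : P.IsSection U s) (hu : u ∈ φ.target)
    (hU : φ.symm u ∈ U) : ∀ᶠ v in 𝓝 u, v ∈ φ.target ∧ φ.symm v ∈ U :=
  (φ.open_target.eventually_mem hu).and ((φ.continuousAt_symm hu).eventually (hs.1.mem_nhds hU))

lemma GStructure.IsSection.coordMetric_frame (hs : P.IsSection U s)
    (hφ : φ ∈ IsManifold.maximalAtlas 𝓘(ℝ, Vec n) ∞ M) (hu : u ∈ φ.target) (hU : φ.symm u ∈ U)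
    (X Y : Vec n) :
    coordMetric g φ u (frameInChart φ s u X) (frameInChart φ s u Y) = inner ℝ X Y := by
  rw [coordMetric_apply, ← P.orthonormal _ _ (hs.2.1 _ hU)]
  have h := chartInvDeriv_mfderiv hφ hu
  exact congr (congrArg (fun L => ⇑(g.inner (φ.symm u) L)) (h (s _ X))) (h (s _ Y))

lemma GStructure.IsSection.isUnit_frame (hs : P.IsSection U s)
    (hφ : φ ∈ IsManifold.maximalAtlas 𝓘(ℝ, Vec n) ∞ M) (hu : u ∈ φ.target)
    (hU : φ.symm u ∈ U) : IsUnit (frameInChart φ s u) := by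
  refine isUnit_of_injective ((injective_iff_map_eq_zero _).mpr fun X hX => ?_)
  have h := hs.coordMetric_frame hφ hu hU X X
  rw [hX, map_zero] at h
  exact (inner_self_eq_zero (𝕜 := ℝ)).mp h.symm

lemma GStructure.IsSection.contDiffAt_frame (hs : P.IsSection U s)
    (hφ : φ ∈ IsManifold.maximalAtlas 𝓘(ℝ, Vec n) ∞ M) (hu : u ∈ φ.target)
    (hU : φ.symm u ∈ U) : ContDiffAt ℝ ∞ (frameInChart φ s) u :=
  contDiffAt_clm_of_apply fun a => contDiffAt_chart_apply hφ hu hs.1 hU (hs.2.2 a)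

variable (g φ s) in
/-- The connection form of the Levi-Civita connection in the frame `s` and the chart `φ`. -/
def sectionForm : Vec n → Vec n →L[ℝ] Vec n →L[ℝ] Vec n :=
  frameForm (christoffelForm (coordMetric g φ)) (frameInChart φ s)

lemma GStructure.IsSection.isFrameConnection (hs : P.IsSection U s)
    (hφ : φ ∈ IsManifold.maximalAtlas 𝓘(ℝ, Vec n) ∞ M) (hu : u ∈ φ.target)
    (hU : φ.symm u ∈ U) :
    IsFrameConnection (christoffelForm (coordMetric g φ)) (frameInChart φ s) (sectionForm φ g s)
      u :=
  isFrameConnection_leviCivita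
    ((φ.open_target.eventually_mem hu).mono fun _ =>
      contDiffAt_coordMetric hφ)
    (Eventually.of_forall fun _ => coordMetric_symm _)
    (isInvertible_of_pos fun _ => coordMetric_pos hφ hu) (hs.contDiffAt_frame hφ hu hU)
    ((hs.eventually_mem hu hU).mono fun _ hv => hs.isUnit_frame hφ hv.1 hv.2)

lemma connectionForm_eq_sectionForm (u X Y : Vec n) :
    connectionForm g φ s u X Y = sectionForm φ g s u X Y := by
  rw [sectionForm, frameForm_apply, ContinuousLinearMap.ringInverse_eq_inverse]
  rfl

/-- The bridge from the hypothesis on the intrinsic torsion to the local theory, valid on a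
neighbourhood as the differentiations require. -/
lemma GStructure.TorsionIn.torsionFormIn {W : Subrepresentation (tensorRep G)}
    (hξ : P.TorsionIn W) (hs : P.IsSection U s)
    (hφ : φ ∈ IsManifold.maximalAtlas 𝓘(ℝ, Vec n) ∞ M) (hu : u ∈ φ.target)
    (hU : φ.symm u ∈ U) : ∀ᶠ v in 𝓝 u, TorsionFormIn W (sectionForm φ g s v) := by
  filter_upwards [hs.eventually_mem hu hU] with v hv
  obtain ⟨ξ, hW, h1, h2⟩ := hξ φ hφ U s hs v hv.1 hv.2
  refine ⟨ξ, hW, h1, fun X => ?_⟩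
  obtain ⟨A, hA, h3⟩ := h2 X
  exact ⟨A, hA, fun Y => by rw [← connectionForm_eq_sectionForm, h3]⟩

variable (g φ s) in
/-- The curvature in the frame `s` and the chart `φ`. -/
def sectionCurv : Vec n → Vec n →L[ℝ] Vec n →L[ℝ] Vec n →L[ℝ] Vec n :=
  frameCurv (frameInChart φ s) (sectionForm φ g s)

/-- Conjugate endomorphisms have the same trace; the right-hand sum is in the coordinate form used
by `ricci`. -/
lemma trace_conj_of_isUnit {e : Vec n →L[ℝ] Vec n} (he : IsUnit e) {A B : Vec n →ₗ[ℝ] Vec n}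
    (h : ∀ X, e (B X) = A (e X)) : ∑ i, inner ℝ (sb i) (B (sb i)) = ∑ i, A (sb i) i := by
  have h1 : A = (e : Vec n →ₗ[ℝ] Vec n) ∘ₗ (B ∘ₗ (Ring.inverse e : Vec n →L[ℝ] Vec n)) :=
    LinearMap.ext fun X => by
      conv_lhs => rw [← (isUnit_clm he).2 X]
      exact (h _).symm
  have h2 : (B ∘ₗ (Ring.inverse e : Vec n →L[ℝ] Vec n)) ∘ₗ (e : Vec n →ₗ[ℝ] Vec n) = B :=
    LinearMap.ext fun X => congrArg B ((isUnit_clm he).1 X)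
  have h3 : LinearMap.trace ℝ (Vec n) A = LinearMap.trace ℝ (Vec n) B := by
    rw [h1, LinearMap.trace_comp_comm', h2]
  rw [trace_eq_sum_sb, trace_eq_sum_sb] at h3
  refine (Finset.sum_congr rfl fun i _ => real_inner_comm _ _).trans (h3.symm.trans
    (Finset.sum_congr rfl fun i _ => ?_))
  rw [real_inner_comm]
  exact (EuclideanSpace.inner_single_left i (1 : ℝ) _).trans (by simp)

lemma GStructure.IsSection.ricci_frame (hs : P.IsSection U s)
    (hφ : φ ∈ IsManifold.maximalAtlas 𝓘(ℝ, Vec n) ∞ M) (hu : u ∈ φ.target)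
    (hU : φ.symm u ∈ U) (Y Z : Vec n) :
    ricci g φ u (frameInChart φ s u Y) (frameInChart φ s u Z) =
      ric (toLin₃ (sectionCurv φ g s u)) Y Z := by
  have h := hs.isFrameConnection hφ hu hU
  rw [ric_apply]
  let A : Vec n →ₗ[ℝ] Vec n := LinearMap.applyₗ (frameInChart φ s u Z) ∘ₗ
    LinearMap.applyₗ (frameInChart φ s u Y) ∘ₗ
      toLin₃ (curvForm (christoffelForm (coordMetric g φ)) u)
  let B : Vec n →ₗ[ℝ] Vec n := LinearMap.applyₗ Z ∘ₗ LinearMap.applyₗ Y ∘ₗ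
    toLin₃ (sectionCurv φ g s u)
  refine Eq.trans ?_ (trace_conj_of_isUnit (A := A) (B := B) h.isUnit.self_of_nhds
    fun X => h.frame_frameCurv X Y Z).symm
  refine Finset.sum_congr rfl fun i _ => ?_
  have h1 := curvForm_apply_eq h.smooth_christoffel (sb i) (frameInChart φ s u Y)
    (frameInChart φ s u Z)
  exact congrArg (fun w : Vec n => w i) h1.symm

end ChartFrames

/-! ### The Einstein function: independence of choices and local constancy. -/

section EinsteinMetric

open Topology Filter

variable {n : ℕ} {M : Type*} [TopologicalSpace M] [ChartedSpace (Vec n) M]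
  [IsManifold 𝓘(ℝ, Vec n) ∞ M] {g : RiemMetric n M} {φ : OpenPartialHomeomorph M (Vec n)}
  {G : Subgroup (Vec n ≃ₗᵢ[ℝ] Vec n)} {P : GStructure g G} {U : Set M}
  {s : ∀ y : M, Vec n →L[ℝ] TangentSpace 𝓘(ℝ, Vec n) y} {u : Vec n}
  {W : Subrepresentation (tensorRep G)}

/-- The curvature in a frame does not depend on the chart. -/
lemma GStructure.TorsionIn.sectionCurv_change (hξ : P.TorsionIn W) (hs : P.IsSection U s)
    (hφ : φ ∈ IsManifold.maximalAtlas 𝓘(ℝ, Vec n) ∞ M) {ψ : OpenPartialHomeomorph M (Vec n)}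
    (hψ : ψ ∈ IsManifold.maximalAtlas 𝓘(ℝ, Vec n) ∞ M) (hu : u ∈ φ.target)
    (hU : φ.symm u ∈ U) (hu' : φ.symm u ∈ ψ.source) :
    sectionCurv φ g s u = sectionCurv ψ g s (ψ (φ.symm u)) := by
  have hu'' : ψ.symm (ψ (φ.symm u)) ∈ U := by rwa [ψ.left_inv hu']
  refine (hs.isFrameConnection hφ hu hU).frameCurv_change (τ := fun v => ψ (φ.symm v))
    (hs.isFrameConnection hψ (ψ.map_source hu') hu'') (contDiffAt_transition hφ hψ hu hu') ?_
    ((hξ.torsionFormIn hs hφ hu hU).mono fun v hv => hv.skew)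
    ((hξ.torsionFormIn hs hψ (ψ.map_source hu') hu'').mono fun v hv => hv.skew)
  filter_upwards [φ.open_target.eventually_mem hu,
    (φ.continuousAt_symm hu).eventually (ψ.open_source.eventually_mem hu')] with v h1 h2 Y
  rw [frameInChart_apply_chart h2]
  exact (fderiv_transition hφ hψ h1 h2 _).symm

lemma GStructure.TorsionIn.ric_sectionCurv
    (ha : NoInvariants G (((stdRep G).tprod W.toRepresentation).tprod
      (traceFreeSym G).toRepresentation))
    (hb : NoInvariants G ((symSquare G W.toRepresentation).toRepresentation.tprod
      (traceFreeSym G).toRepresentation))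
    (hc : NoInvariants G ((algCurv G).toRepresentation.tprod
      (traceFreeSym G).toRepresentation))
    (hξ : P.TorsionIn W) (hs : P.IsSection U s)
    (hφ : φ ∈ IsManifold.maximalAtlas 𝓘(ℝ, Vec n) ∞ M) (hu : u ∈ φ.target) (hU : φ.symm u ∈ U)
    (Y Z : Vec n) : ric (toLin₃ (sectionCurv φ g s u)) Y Z =
      einsteinConst (sectionCurv φ g s u) * inner ℝ Y Z :=
  (hs.isFrameConnection hφ hu hU).ric_eq ha hb hc (hξ.torsionFormIn hs hφ hu hU) Y Z

lemma GStructure.TorsionIn.ricci_eq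
    (ha : NoInvariants G (((stdRep G).tprod W.toRepresentation).tprod
      (traceFreeSym G).toRepresentation))
    (hb : NoInvariants G ((symSquare G W.toRepresentation).toRepresentation.tprod
      (traceFreeSym G).toRepresentation))
    (hc : NoInvariants G ((algCurv G).toRepresentation.tprod
      (traceFreeSym G).toRepresentation))
    (hξ : P.TorsionIn W) (hs : P.IsSection U s)
    (hφ : φ ∈ IsManifold.maximalAtlas 𝓘(ℝ, Vec n) ∞ M) (hu : u ∈ φ.target) (hU : φ.symm u ∈ U)
    (b c : Vec n) :
    ricci g φ u b c = einsteinConst (sectionCurv φ g s u) * coordMetric g φ u b c := by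
  have he := isUnit_clm (hs.isUnit_frame hφ hu hU)
  rw [← he.2 b, ← he.2 c, hs.ricci_frame hφ hu hU, hs.coordMetric_frame hφ hu hU,
    hξ.ric_sectionCurv ha hb hc hs hφ hu hU]

/-- The Einstein constant depends neither on the frame nor on the chart. -/
lemma GStructure.TorsionIn.einsteinConst_unique
    (ha : NoInvariants G (((stdRep G).tprod W.toRepresentation).tprod
      (traceFreeSym G).toRepresentation))
    (hb : NoInvariants G ((symSquare G W.toRepresentation).toRepresentation.tprod
      (traceFreeSym G).toRepresentation))
    (hc : NoInvariants G ((algCurv G).toRepresentation.tprod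
      (traceFreeSym G).toRepresentation))
    (hξ : P.TorsionIn W) (hs : P.IsSection U s) {U' : Set M}
    {s' : ∀ y : M, Vec n →L[ℝ] TangentSpace 𝓘(ℝ, Vec n) y} (hs' : P.IsSection U' s')
    (hφ : φ ∈ IsManifold.maximalAtlas 𝓘(ℝ, Vec n) ∞ M) {ψ : OpenPartialHomeomorph M (Vec n)}
    (hψ : ψ ∈ IsManifold.maximalAtlas 𝓘(ℝ, Vec n) ∞ M) (hu : u ∈ φ.target)
    (hU : φ.symm u ∈ U) (hU' : φ.symm u ∈ U') (hu' : φ.symm u ∈ ψ.source) :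
    einsteinConst (sectionCurv φ g s u) = einsteinConst (sectionCurv ψ g s' (ψ (φ.symm u))) := by
  rw [← hξ.sectionCurv_change hs' hφ hψ hu hU' hu']
  rcases Nat.eq_zero_or_pos n with rfl | hn
  -- For `n = 0` the equation `Ric = λ g` says nothing about `λ`, but both constants are `0` because
  -- `(0 : ℝ)⁻¹ = 0`.
  · simp [einsteinConst]
  · have : NeZero n := ⟨hn.ne'⟩
    have h0 : (sb 0 : Vec n) ≠ 0 := by simp [sb]
    have h1 := hξ.ricci_eq ha hb hc hs hφ hu hU (sb 0) (sb 0)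
    rw [hξ.ricci_eq ha hb hc hs' hφ hu hU' (sb 0) (sb 0)] at h1
    exact (mul_right_cancel₀ (coordMetric_pos hφ hu h0).ne' h1).symm

/-- The Einstein constant of the metric is constant on a neighbourhood of each point. -/
lemma GStructure.TorsionIn.eventually_einsteinConst_eq
    (ha : NoInvariants G (((stdRep G).tprod W.toRepresentation).tprod
      (traceFreeSym G).toRepresentation))
    (hb : NoInvariants G ((symSquare G W.toRepresentation).toRepresentation.tprod
      (traceFreeSym G).toRepresentation))
    (hc : NoInvariants G ((algCurv G).toRepresentation.tprod
      (traceFreeSym G).toRepresentation))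
    (hξ : P.TorsionIn W) (hs : P.IsSection U s)
    (hφ : φ ∈ IsManifold.maximalAtlas 𝓘(ℝ, Vec n) ∞ M) (hu : u ∈ φ.target) (hU : φ.symm u ∈ U)
    (hn : n ≠ 2) : ∀ᶠ v in 𝓝 u,
      einsteinConst (sectionCurv φ g s v) = einsteinConst (sectionCurv φ g s u) := by
  have h1 : ∀ v, v ∈ φ.target → φ.symm v ∈ U →
      fderiv ℝ (fun v => einsteinConst (sectionCurv φ g s v)) v = 0 := by
    intro v hv hv'
    have h := hs.eventually_mem hv hv'
    exact (hs.isFrameConnection hφ hv hv').fderiv_einsteinConst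
      (hξ.torsionFormIn hs hφ hv hv').self_of_nhds.skew
      (h.mono fun w hw => (hs.isFrameConnection hφ hw.1 hw.2).inner_frameCurv
        ((hξ.torsionFormIn hs hφ hw.1 hw.2).mono fun _ hx => hx.skew))
      (h.mono fun w hw => hξ.ric_sectionCurv ha hb hc hs hφ hw.1 hw.2) hn
  have h2 : ∀ v, v ∈ φ.target → φ.symm v ∈ U →
      DifferentiableAt ℝ (fun v => einsteinConst (sectionCurv φ g s v)) v := fun v hv hv' =>
    (LinearMap.toContinuousLinearMap (einsteinConst (n := n))).differentiableAt.comp v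
      ((hs.isFrameConnection hφ hv hv').smooth_frameCurv.differentiableAt (by simp))
  -- A ball is connected, so vanishing of the derivative on it gives constancy.
  obtain ⟨r, hr, hb'⟩ := Metric.eventually_nhds_iff_ball.mp (hs.eventually_mem hu hU)
  filter_upwards [Metric.ball_mem_nhds u hr] with v hv
  exact Metric.isOpen_ball.is_const_of_fderiv_eq_zero (convex_ball u r).isPreconnected
    (fun w hw => (h2 w (hb' w hw).1 (hb' w hw).2).differentiableWithinAt)
    (fun w hw => h1 w (hb' w hw).1 (hb' w hw).2) hv (Metric.mem_ball_self hr)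

end EinsteinMetric

end

end GStructures

open GStructures

theorem theorem1 {n : ℕ} {M : Type*} [TopologicalSpace M] [ChartedSpace (Vec n) M]
    [IsManifold 𝓘(ℝ, Vec n) ∞ M] (g : RiemMetric n M)
    (G : Subgroup (Vec n ≃ₗᵢ[ℝ] Vec n)) (P : GStructure g G)
    (W : Subrepresentation (tensorRep G))
    (hW : ∀ ξ ∈ W.toSubmodule, ∀ X, ξ X ∈ lieAlgPerp G)
    (hξ : P.TorsionIn W)
    (ha : NoInvariants G (((stdRep G).tprod W.toRepresentation).tprod
      (traceFreeSym G).toRepresentation))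
    (hb : NoInvariants G ((symSquare G W.toRepresentation).toRepresentation.tprod
      (traceFreeSym G).toRepresentation))
    (hc : NoInvariants G ((algCurv G).toRepresentation.tprod
      (traceFreeSym G).toRepresentation)) :
    IsEinstein g := by
  have hsec : ∀ x : M, ∃ (U : Set M) (s : ∀ y : M, Vec n →L[ℝ] TangentSpace 𝓘(ℝ, Vec n) y),
      x ∈ U ∧ P.IsSection U s := fun x => by
    obtain ⟨U, hU, hx, s, h1, h2⟩ := P.exists_section x
    exact ⟨U, s, hx, hU, h1, h2⟩
  choose U s hU hs using hsec
  have hatlas := fun x : M => IsManifold.chart_mem_maximalAtlas (I := 𝓘(ℝ, Vec n)) (n := ∞) x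
  -- The chart and the section used in this definition vary with `x`; `hlam` replaces them by any
  -- others, so that near a point `lam` can be computed with a single chart and a single section.
  let lam : M → ℝ := fun x =>
    einsteinConst (sectionCurv (chartAt (Vec n) x) g (s x) (chartAt (Vec n) x x))
  have hlam : ∀ φ ∈ IsManifold.maximalAtlas 𝓘(ℝ, Vec n) ∞ M, ∀ u ∈ φ.target, ∀ y,
      φ.symm u ∈ U y → einsteinConst (sectionCurv φ g (s y) u) = lam (φ.symm u) :=
    fun φ hφ u hu y hy => hξ.einsteinConst_unique ha hb hc (hs y) (hs _) hφ (hatlas _) hu hy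
      (hU _) (mem_chart_source _ _)
  refine ⟨lam, fun φ hφ u hu b c => ?_, fun hn => ?_⟩
  · rw [hξ.ricci_eq ha hb hc (hs _) hφ hu (hU _), hlam φ hφ u hu _ (hU _)]
  · refine (IsLocallyConstant.iff_eventually_eq _).mpr fun x => ?_
    have hx := mem_chart_source (Vec n) x
    have hx' : (chartAt (Vec n) x).symm (chartAt (Vec n) x x) ∈ U x := by
      rw [(chartAt (Vec n) x).left_inv hx]
      exact hU x
    have h := ((chartAt (Vec n) x).continuousAt hx).eventually
      (hξ.eventually_einsteinConst_eq ha hb hc (hs x) (hatlas x)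
        ((chartAt (Vec n) x).map_source hx) hx' hn)
    filter_upwards [h, (hs x).1.eventually_mem (hU x),
      (chartAt (Vec n) x).open_source.eventually_mem hx] with y h1 h2 h3
    have h4 := hlam _ (hatlas x) _ ((chartAt (Vec n) x).map_source h3) x
      (by rwa [(chartAt (Vec n) x).left_inv h3])
    rw [(chartAt (Vec n) x).left_inv h3] at h4
    rw [← h4, h1]
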